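/- **Model.** Let $\beta>0$, $\mathsf v>0$, $\mathsf b\ge 0$, and let $(g_{ij})_{1\le i<j}$ be independent standard Gaussian random variables on a probability space, with expectation denoted by $\mathbb E$. For $N\ge 2$ let $S^x_i$ and $S^z_i$ ($1\le i\le N$) be the operators on $(\mathbb C^2)^{\otimes N}$ that act as the Pauli matrices $$S^x=\begin{pmatrix}0&1\\1&0\end{pmatrix},\qquad S^z=\begin{pmatrix}1&0\\0&-1\end{pmatrix}$$ on the $i$-th tensor factor and as the identity on all the others. Consider the Hamiltonian of the Sherrington–Kirkpatrick model in a transverse field, $$H_N=-\frac{\mathsf v}{\sqrt N}\sum_{1\le i<j\le N} g_{ij}\,S^z_iS^z_j-\mathsf b\sum_{i=1}^N S^x_i ,$$ the partition function $Z_N=\operatorname{Tr} e^{-\beta H_N}$, the free energy $f_N=-\frac1{\beta N}\ln Z_N$, the quenched free energy $\mathbb E[f_N]$, and the annealed free energy $f_N^{\mathrm{ann}}=-\frac1{\beta N}\ln \mathbb E[Z_N]$. Put $\lambda=\beta^2\mathsf v^2/4$. **Theorem (the macroscopic quenched free energy for weak disorder).** If $4\lambda=\beta^2\mathsf v^2<1$,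 then $Z_N$ and $f_N$ are integrable for every $N\ge2$, the macroscopic annealed free energy $f_\infty^{\mathrm{ann}}:=\lim_{N\to\infty}f_N^{\mathrm{ann}}$ exists as a real number, and the limit of the quenched free energy exists and equals it: $$\lim_{N\to\infty}\mathbb E[f_N]=\lim_{N\to\infty}f_N^{\mathrm{ann}}=f_\infty^{\mathrm{ann}} .$$ -/

import Mathlib

open MeasureTheory ProbabilityTheory Filter Topology

noncomputable section

namespace QuantumSK

/-- The Pauli matrix `S^x` in the eigenbasis of `S^z`. -/
def pauliX : Matrix (Fin 2) (Fin 2) ℂ := !![0, 1; 1, 0]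

/-- The Pauli matrix `S^z` in its own eigenbasis. -/
def pauliZ : Matrix (Fin 2) (Fin 2) ℂ := !![1, 0; 0, -1]

/-- The operator `A 0 ⊗ ⋯ ⊗ A (N-1)` on `(ℂ²)^{⊗N}`, as a matrix in the product basis, whose
elements are indexed by the configurations `Fin N → Fin 2`. -/
def tensorMatrix {N : ℕ} (A : Fin N → Matrix (Fin 2) (Fin 2) ℂ) :
    Matrix (Fin N → Fin 2) (Fin N → Fin 2) ℂ :=
  Matrix.of fun s t => ∏ k, A k (s k) (t k)

/-- The operator `1 ⊗ ⋯ ⊗ 1 ⊗ S ⊗ 1 ⊗ ⋯ ⊗ 1` with `S` as the `i`-th factor. -/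
def siteOperator {N : ℕ} (S : Matrix (Fin 2) (Fin 2) ℂ) (i : Fin N) :
    Matrix (Fin N → Fin 2) (Fin N → Fin 2) ℂ :=
  tensorMatrix (Function.update (fun _ => 1) i S)

/-- The Hamiltonian
`H_N = -(v / √N) ∑_{i < j} J_{ij} S_i^z S_j^z - b ∑_i S_i^x`
of `N` spins for given values `J i j` of the couplings (sites are numbered from `0`; only the
values `J i j` with `i < j < N` enter). -/
def hamiltonian (v b : ℝ) (N : ℕ) (J : ℕ → ℕ → ℝ) :
    Matrix (Fin N → Fin 2) (Fin N → Fin 2) ℂ :=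
  -((v / √(N : ℝ) : ℝ) : ℂ) •
      (∑ i : Fin N, ∑ j ∈ Finset.Ioi i,
        ((J i j : ℝ) : ℂ) • (siteOperator pauliZ i * siteOperator pauliZ j))
    - (b : ℂ) • ∑ i : Fin N, siteOperator pauliX i

/-- The partition function `Z_N = Tr exp(-β H_N)`; this trace is a real number, see
`trace_exp_eq_partitionFunction`. -/
def partitionFunction (β v b : ℝ) (N : ℕ) (J : ℕ → ℕ → ℝ) : ℝ :=
  (Matrix.trace (NormedSpace.exp (-(β : ℂ) • hamiltonian v b N J))).re

/-- The specific free energy `f_N = -(1 / (β N)) ln Z_N`. -/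
def freeEnergy (β v b : ℝ) (N : ℕ) (J : ℕ → ℕ → ℝ) : ℝ :=
  -(1 / (β * N)) * Real.log (partitionFunction β v b N J)

/-- The quenched free energy `E[f_N]` for random couplings `g`. -/
def quenchedFreeEnergy {Ω : Type*} [MeasurableSpace Ω] (P : Measure Ω) (g : ℕ → ℕ → Ω → ℝ)
    (β v b : ℝ) (N : ℕ) : ℝ :=
  ∫ ω, freeEnergy β v b N (fun i j => g i j ω) ∂P

/-- The annealed free energy `f_N^ann = -(1 / (β N)) ln E[Z_N]` for random couplings `g`. -/
def annealedFreeEnergy {Ω : Type*} [MeasurableSpace Ω] (P : Measure Ω) (g : ℕ → ℕ → Ω → ℝ)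
    (β v b : ℝ) (N : ℕ) : ℝ :=
  -(1 / (β * N)) * Real.log (∫ ω, partitionFunction β v b N (fun i j => g i j ω) ∂P)

/-- The macroscopic annealed free energy `f_∞^ann = lim_{N → ∞} f_N^ann`. -/
def macroscopicAnnealedFreeEnergy {Ω : Type*} [MeasurableSpace Ω] (P : Measure Ω)
    (g : ℕ → ℕ → Ω → ℝ) (β v b : ℝ) : ℝ :=
  limUnder atTop (fun N : ℕ => annealedFreeEnergy P g β v b N)

/-- The dimensionless disorder parameter `λ = β² v² / 4`. -/
def disorderParameter (β v : ℝ) : ℝ := β ^ 2 * v ^ 2 / 4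

/-- The couplings `g i j`, `i < j`, are independent standard Gaussian random variables. -/
structure IsGaussianDisorder {Ω : Type*} [MeasurableSpace Ω] (P : Measure Ω)
    (g : ℕ → ℕ → Ω → ℝ) : Prop where
  hasLaw : ∀ i j, i < j → HasLaw (g i j) (gaussianReal 0 1) P
  indep : iIndepFun (fun (p : {p : ℕ × ℕ // p.1 < p.2}) => g p.1.1 p.1.2) P

theorem tensorMatrix_isHermitian {N : ℕ} {A : Fin N → Matrix (Fin 2) (Fin 2) ℂ}
    (hA : ∀ k, (A k).IsHermitian) : (tensorMatrix A).IsHermitian := by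
  ext s t
  simp only [tensorMatrix, Matrix.conjTranspose_apply, Matrix.of_apply, star_prod]
  exact Finset.prod_congr rfl fun k _ => (hA k).apply _ _

theorem siteOperator_isHermitian {N : ℕ} {S : Matrix (Fin 2) (Fin 2) ℂ} (hS : S.IsHermitian)
    (i : Fin N) : (siteOperator S i).IsHermitian := by
  refine tensorMatrix_isHermitian fun k => ?_
  by_cases h : k = i
  · subst h; simpa using hS
  · simp [Function.update_of_ne h]

theorem tensorMatrix_mul {N : ℕ} (A B : Fin N → Matrix (Fin 2) (Fin 2) ℂ) :
    tensorMatrix A * tensorMatrix B = tensorMatrix (fun k => A k * B k) := by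
  ext s t
  simp only [tensorMatrix, Matrix.mul_apply, Matrix.of_apply, ← Finset.prod_mul_distrib]
  rw [Finset.prod_univ_sum, Fintype.piFinset_univ]

theorem siteOperator_commute {N : ℕ} (S : Matrix (Fin 2) (Fin 2) ℂ) (i j : Fin N) :
    Commute (siteOperator S i) (siteOperator S j) := by
  simp only [Commute, SemiconjBy, siteOperator, tensorMatrix_mul]
  congr 1
  funext k
  by_cases hi : k = i <;> by_cases hj : k = j <;> simp_all

theorem hamiltonian_isHermitian (v b : ℝ) (N : ℕ) (J : ℕ → ℕ → ℝ) :
    (hamiltonian v b N J).IsHermitian := by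
  have hr : ∀ r : ℝ, IsSelfAdjoint (r : ℂ) := fun r => Complex.conj_ofReal r
  have hZ : pauliZ.IsHermitian := by
    ext i j; fin_cases i <;> fin_cases j <;> simp [pauliZ]
  have hX : pauliX.IsHermitian := by
    ext i j; fin_cases i <;> fin_cases j <;> simp [pauliX]
  have hS : ∀ M : Matrix (Fin N → Fin 2) (Fin N → Fin 2) ℂ, ∀ r : ℂ, IsSelfAdjoint r →
      M.IsHermitian → (r • M).IsHermitian := fun M r h1 h2 => IsSelfAdjoint.smul h1 h2
  unfold hamiltonian
  refine Matrix.IsHermitian.sub (hS _ _ (hr _).neg ?_) (hS _ _ (hr _) ?_)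
  · refine isSelfAdjoint_sum _ fun i _ => isSelfAdjoint_sum _ fun j _ => hS _ _ (hr _) ?_
    exact (Matrix.IsHermitian.commute_iff (siteOperator_isHermitian hZ i)
      (siteOperator_isHermitian hZ j)).1 (siteOperator_commute _ _ _)
  · exact isSelfAdjoint_sum _ fun i _ => siteOperator_isHermitian hX i

theorem trace_exp_eq_partitionFunction (β v b : ℝ) (N : ℕ) (J : ℕ → ℕ → ℝ) :
    Matrix.trace (NormedSpace.exp (-(β : ℂ) • hamiltonian v b N J)) =
      (partitionFunction β v b N J : ℂ) := by
  have h0 : IsSelfAdjoint (-(β : ℂ)) := IsSelfAdjoint.neg (Complex.conj_ofReal β)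
  have h1 : (-(β : ℂ) • hamiltonian v b N J).IsHermitian :=
    IsSelfAdjoint.smul h0 (hamiltonian_isHermitian v b N J)
  have h2 := h1.exp
  have h3 := Matrix.trace_conjTranspose (NormedSpace.exp (-(β : ℂ) • hamiltonian v b N J))
  rw [h2.eq] at h3
  exact (Complex.conj_eq_iff_re.1 h3.symm).symm

end QuantumSK

end

/-!
The proof compares `E ln Z` with `ln E Z` by the second moment method, after writing `Z` as a
classical partition function of spin paths.

**Path representation.** By the Trotter formula (`tendsto_pathZ`), `Z` is the limit of the
partition functions `pathZ` of `N` closed paths with values `±1`. The transverse field gives a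
product of single-path weights, nonnegative since `b ≥ 0` and invariant under the flip of any
single path; the couplings enter only through the overlaps of pairs of paths.

**Second moment.** The Gaussian average of `Z²` is a sum over two replicas whose interaction is
`exp ((a / N) ∑_{i<j} q_ij q'_ij)` with `a = β² v²` and `q`, `q'` the overlaps of the replicas.
Flipping the paths of one replica independently inserts random signs `ε_i ε_j`. The exponent is then
at most a mean over pairs of times of `(a / 2N) (∑ ± ε_i)²`, so that Jensen's inequality and the
subgaussian bound for Rademacher sums give `E Z² ≤ C (E Z)²` with `C = E exp (a g² / 2)`, finite
exactly for `a < 1` (`integral_pathZ_sq_le`, `integral_pairPartition_sq_le`).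

**Concentration.** `ln Z` is Lipschitz in each coupling with constant `βv / √N`, so its variance is
`O(N)` by an Efron–Stein bound (`variance_le`, `variance_log_pairPartition_le`). As `Z ≥ E Z / 2`
holds with probability bounded below, `ln E Z - E ln Z = O(√N)` (`log_integral_sub_le`); Jensen's
inequality gives the reverse bound `E ln Z ≤ ln E Z`.

**Annealed limit.** Up to a constant factor, `E Z` is the weighted sum of `exp (N Φ)`, with `Φ` a
convex function of an empirical mean over the sites. Hence `ln E Z` is subadditive in `N` up to a
constant, and Fekete's lemma applies (`pathA_add_le`, `exists_tendsto_log_integral`).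
-/

noncomputable section

namespace QuantumSK

/-! ### Sums over pairs of sites -/

/-- The pairs `i < j` of sites. -/
abbrev Pairs (N : ℕ) : Type := {p : Fin N × Fin N // p.1 < p.2}

theorem sum_pairs_eq_sum_Ioi {N : ℕ} (f : Fin N → Fin N → ℝ) :
    ∑ p : Pairs N, f p.1.1 p.1.2 = ∑ i, ∑ j ∈ Finset.Ioi i, f i j := by
  have h : ∀ i : Fin N, Finset.Ioi i = Finset.univ.filter fun j => i < j := fun i => by
    ext j; simp
  simp only [h, Finset.sum_filter]
  rw [← Finset.sum_product', ← Finset.sum_filter]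
  exact (Finset.sum_subtype _ (by simp) (fun p : Fin N × Fin N => f p.1 p.2)).symm

theorem sum_pairs {N : ℕ} (f : Fin N → Fin N → ℝ) (hf : ∀ i j, f i j = f j i) :
    ∑ p : Pairs N, f p.1.1 p.1.2 = (∑ i, ∑ j, f i j - ∑ i, f i i) / 2 := by
  have h1 : ∑ p : Pairs N, f p.1.1 p.1.2 = ∑ i, ∑ j, if i < j then f i j else 0 := by
    rw [sum_pairs_eq_sum_Ioi]
    refine Finset.sum_congr rfl fun i _ => ?_
    rw [← Finset.sum_filter]
    congr 1
    ext j
    simp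
  have h2 : ∑ i, ∑ j, (if i < j then f i j else 0) = ∑ i, ∑ j, if j < i then f i j else 0 := by
    rw [Finset.sum_comm]
    simp only [hf]
  have h3 : ∑ i, ∑ j, f i j = (∑ i, ∑ j, if i < j then f i j else 0)
      + (∑ i, ∑ j, if j < i then f i j else 0) + ∑ i, f i i := by
    simp only [← Finset.sum_add_distrib]
    refine Finset.sum_congr rfl fun i _ => ?_
    rw [Finset.sum_add_distrib]
    have : f i i = ∑ j, if i = j then f i j else 0 := by simp
    rw [this, ← Finset.sum_add_distrib, ← Finset.sum_add_distrib]
    refine Finset.sum_congr rfl fun j _ => ?_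
    rcases lt_trichotomy i j with h | h | h
    · simp [h, h.not_gt, h.ne]
    · simp [h]
    · simp [h, h.not_gt, h.ne']
  rw [h1, h3, ← h2]
  ring

/-! ### Exponential moments of Gaussian couplings -/

/-- The standard Gaussian measure on `ℝ^ι`. -/
abbrev stdGauss (ι : Type*) [Fintype ι] : Measure (ι → ℝ) :=
  Measure.pi fun _ => gaussianReal 0 1

section Gauss
variable {ι : Type*} [Fintype ι]

theorem integral_exp_mul_gaussianReal (t : ℝ) :
    ∫ x, Real.exp (t * x) ∂(gaussianReal 0 1) = Real.exp (t ^ 2 / 2) := by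
  have := mgf_gaussianReal (p := gaussianReal 0 1) (X := id) (μ := 0) (v := 1) (by simp) t
  simpa [mgf] using this

theorem integrable_exp_stdGauss (a : ι → ℝ) :
    Integrable (fun J => Real.exp (∑ p, a p * J p)) (stdGauss ι) := by
  simp only [Real.exp_sum]
  exact Integrable.fintype_prod (f := fun p x => Real.exp (a p * x))
    fun p => integrable_exp_mul_gaussianReal (a p)

theorem integral_exp_stdGauss (a : ι → ℝ) :
    ∫ J, Real.exp (∑ p, a p * J p) ∂(stdGauss ι) = Real.exp ((∑ p, a p ^ 2) / 2) := by
  simp only [Real.exp_sum]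
  rw [integral_fintype_prod_eq_prod (fun p x => Real.exp (a p * x)), Finset.sum_div, Real.exp_sum]
  simp only [integral_exp_mul_gaussianReal]

theorem integrable_exp_abs_stdGauss (a : ℝ) :
    Integrable (fun J => Real.exp (a * ∑ p, |J p|)) (stdGauss ι) := by
  simp only [Finset.mul_sum, Real.exp_sum]
  refine Integrable.fintype_prod (f := fun _ x => Real.exp (a * |x|)) fun _ => ?_
  have h : Integrable (fun x => Real.exp (a * x) + Real.exp (-a * x)) (gaussianReal 0 1) :=
    (integrable_exp_mul_gaussianReal a).add (integrable_exp_mul_gaussianReal (-a))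
  refine h.mono' (by fun_prop) (.of_forall fun x => ?_)
  rw [Real.norm_of_nonneg (Real.exp_nonneg _)]
  rcases abs_cases x with ⟨h, -⟩ | ⟨h, -⟩ <;> rw [h]
  · exact le_add_of_nonneg_right (Real.exp_nonneg _)
  · rw [mul_neg, ← neg_mul]
    exact le_add_of_nonneg_left (Real.exp_nonneg _)

theorem integrable_exp_sq_gaussianReal {a : ℝ} (ha : a < 1) :
    Integrable (fun x => Real.exp (a * x ^ 2 / 2)) (gaussianReal 0 1) := by
  rw [gaussianReal_of_var_ne_zero 0 one_ne_zero, integrable_withDensity_iff_integrable_smul']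
  · have : Integrable (fun x : ℝ => (√(2 * Real.pi))⁻¹ * Real.exp (-((1 - a) / 2) * x ^ 2)) :=
      (integrable_exp_neg_mul_sq (by linarith)).const_mul _
    refine this.congr (.of_forall fun x => ?_)
    simp only [toReal_gaussianPDF, gaussianPDFReal_def, smul_eq_mul, NNReal.coe_one, mul_one,
      sub_zero]
    rw [mul_assoc, ← Real.exp_add]
    congr 2
    ring
  · exact measurable_gaussianPDF 0 1
  · exact .of_forall fun x => gaussianPDF_lt_top

/-- The second moment constant `E exp(a g² / 2) = (1 - a)^(-1/2)`. -/
def gaussConst (a : ℝ) : ℝ := ∫ x, Real.exp (a * x ^ 2 / 2) ∂(gaussianReal 0 1)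

theorem gaussConst_pos {a : ℝ} (ha : a < 1) : 0 < gaussConst a :=
  integral_exp_pos (integrable_exp_sq_gaussianReal ha)

end Gauss

/-! ### Random signs -/

/-- The sign `±1` encoded by a Boolean. -/
def sgn (e : Bool) : ℝ := if e then -1 else 1

/-- Subgaussian bound for the square of a Rademacher sum: linearising the square by a Gaussian
variable turns the average over the signs into a product of hyperbolic cosines. -/
theorem sum_signs_exp_sq_le {N : ℕ} {a : ℝ} (ha0 : 0 ≤ a) (ha : a < 1) (θ : Fin N → ℝ)
    (hθ : ∀ i, θ i ^ 2 = 1) :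
    ∑ e : Fin N → Bool, Real.exp (a / (2 * N) * (∑ i, sgn (e i) * θ i) ^ 2)
      ≤ 2 ^ N * gaussConst a := by
  set r := √(a / N)
  have hr : r ^ 2 = a / N := Real.sq_sqrt (by positivity)
  have h1 : ∀ S : ℝ, Real.exp (a / (2 * N) * S ^ 2)
      = ∫ x, Real.exp (r * S * x) ∂(gaussianReal 0 1) := fun S => by
    rw [integral_exp_mul_gaussianReal, mul_pow, hr]
    congr 1
    ring
  simp only [h1]
  rw [← integral_finsetSum _ fun e _ => integrable_exp_mul_gaussianReal _, gaussConst,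
    ← integral_const_mul]
  refine integral_mono (integrable_finsetSum _ fun e _ => integrable_exp_mul_gaussianReal _)
    ((integrable_exp_sq_gaussianReal ha).const_mul _) fun x => ?_
  have h2 : ∀ e : Fin N → Bool, Real.exp (r * (∑ i, sgn (e i) * θ i) * x)
      = ∏ i, Real.exp (r * (sgn (e i) * θ i) * x) := fun e => by
    rw [← Real.exp_sum, Finset.mul_sum, Finset.sum_mul]
  simp only [h2]
  rw [← Fintype.piFinset_univ, ← Finset.prod_univ_sum (fun _ => Finset.univ)
    (fun i b => Real.exp (r * (sgn b * θ i) * x))]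
  have h3 : ∀ i, ∑ b, Real.exp (r * (sgn b * θ i) * x) ≤ 2 * Real.exp (r ^ 2 * x ^ 2 / 2) := by
    intro i
    have := Real.cosh_le_exp_half_sq (r * θ i * x)
    rw [Real.cosh_eq, mul_pow, mul_pow, hθ i, mul_one] at this
    simp only [Fintype.sum_bool, sgn, if_true]
    have e1 : r * (-1 * θ i) * x = -(r * θ i * x) := by ring
    have e2 : r * ((if false = true then -1 else 1) * θ i) * x = r * θ i * x := by simp
    rw [e1, e2]
    linarith
  refine (Finset.prod_le_prod (fun i _ => Finset.sum_nonneg fun b _ => Real.exp_nonneg _)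
    fun i _ => h3 i).trans ?_
  simp only [Finset.prod_const, Finset.card_univ, Fintype.card_fin, mul_pow]
  rw [← Real.exp_nat_mul]
  gcongr
  rw [hr]
  rcases Nat.eq_zero_or_pos N with h | h
  · subst h; simp; positivity
  · refine le_of_eq ?_
    field_simp

/-! ### Partition functions of classical spin paths -/

/-- The overlap of two spin paths, the average over times `k` of the products of their values;
`u x k` is the spin at time `k` of the path labelled `x`. -/
def overlap {X K : Type*} [Fintype K] (u : X → K → ℝ) (x y : X) : ℝ :=
  (∑ k, u x k * u y k) / Fintype.card K

/-- The partition function of `N` classical spin paths with single-path weights `w`, pair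
couplings `J`, and the interaction `J i j * overlap` scaled by `c`. -/
def pathZ {X K : Type*} [Fintype X] [Fintype K] (w : X → ℝ) (u : X → K → ℝ) (c : ℝ) {N : ℕ}
    (J : Pairs N → ℝ) : ℝ :=
  ∑ x : Fin N → X, (∏ i, w (x i)) *
    Real.exp (∑ p : Pairs N, c * overlap u (x p.1.1) (x p.1.2) * J p)

/-- The annealed partition function of `N` spin paths: the weighted sum of
`exp (a / (4N) * ∑ i j, overlap²)`, the diagonal `i = j` included. -/
def pathA {X K : Type*} [Fintype X] [Fintype K] (w : X → ℝ) (u : X → K → ℝ) (a : ℝ) (N : ℕ) : ℝ :=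
  ∑ x : Fin N → X, (∏ i, w (x i)) *
    Real.exp (a / 4 * ((∑ i, ∑ j, overlap u (x i) (x j) ^ 2) / N))

section Path
variable {X K : Type*} [Fintype K] {w : X → ℝ} {u : X → K → ℝ} {N : ℕ}

theorem overlap_comm (x y : X) : overlap u x y = overlap u y x := by
  simp only [overlap, mul_comm]

theorem overlap_self [Nonempty K] (hu : ∀ x k, u x k ^ 2 = 1) (x : X) : overlap u x x = 1 := by
  simp [overlap, ← sq, hu]

theorem abs_overlap_le_one (hu : ∀ x k, u x k ^ 2 = 1) (x y : X) :
    |overlap u x y| ≤ 1 := by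
  have h1 : ∀ x k, |u x k| = 1 := fun x k => by
    rw [← pow_eq_one_iff_of_nonneg (abs_nonneg _) two_ne_zero, sq_abs, hu]
  rw [overlap, abs_div, Nat.abs_cast]
  refine div_le_one_of_le₀ ((Finset.abs_sum_le_sum_abs _ _).trans ?_) (by positivity)
  simp [abs_mul, h1]

/-- A double sum over sites of products of overlaps is a mean over pairs of times of squares of
sums over sites. -/
theorem sum_overlap_mul_overlap (d : Fin N → ℝ) (x y : Fin N → X) :
    ∑ i, ∑ j, d i * d j * (overlap u (x i) (x j) * overlap u (y i) (y j))
      = (∑ k, ∑ l, (∑ i, d i * (u (x i) k * u (y i) l)) ^ 2) / (Fintype.card K : ℝ) ^ 2 := by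
  have h1 : ∀ i j, d i * d j * (overlap u (x i) (x j) * overlap u (y i) (y j))
      = (∑ k, ∑ l, d i * d j * (u (x i) k * u (x j) k * (u (y i) l * u (y j) l)))
        / (Fintype.card K : ℝ) ^ 2 := fun i j => by
    rw [overlap, overlap, div_mul_div_comm, ← sq, Finset.sum_mul_sum, ← mul_div_assoc,
      Finset.mul_sum]
    simp only [Finset.mul_sum]
  simp only [h1, ← Finset.sum_div]
  congr 1
  have h2 : ∀ k l, (∑ i, d i * (u (x i) k * u (y i) l)) ^ 2
      = ∑ i, ∑ j, d i * d j * (u (x i) k * u (x j) k * (u (y i) l * u (y j) l)) := fun k l => by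
    rw [sq, Finset.sum_mul_sum]
    refine Finset.sum_congr rfl fun i _ => Finset.sum_congr rfl fun j _ => ?_
    ring
  simp only [h2]
  calc _ = ∑ i, ∑ k, ∑ j, ∑ l,
        d i * d j * (u (x i) k * u (x j) k * (u (y i) l * u (y j) l)) :=
        Finset.sum_congr rfl fun i _ => Finset.sum_comm
    _ = ∑ k, ∑ i, ∑ j, ∑ l, d i * d j * (u (x i) k * u (x j) k * (u (y i) l * u (y j) l)) :=
        Finset.sum_comm
    _ = ∑ k, ∑ i, ∑ l, ∑ j, d i * d j * (u (x i) k * u (x j) k * (u (y i) l * u (y j) l)) :=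
        Finset.sum_congr rfl fun k _ => Finset.sum_congr rfl fun i _ => Finset.sum_comm
    _ = _ := Finset.sum_congr rfl fun k _ => Finset.sum_comm

theorem sum_overlap_sq (x : Fin N → X) : ∑ i, ∑ j, overlap u (x i) (x j) ^ 2
      = (∑ k, ∑ l, (∑ i, u (x i) k * u (x i) l) ^ 2) / (Fintype.card K : ℝ) ^ 2 := by
  simpa [sq] using sum_overlap_mul_overlap (u := u) (fun _ => 1) x x

/-- Averaged over independent sign flips of the sites, the interaction of two replicas is bounded
uniformly in `N`: the exponent is a mean over pairs of times of squares of Rademacher sums, so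
Jensen's inequality applies. -/
theorem sum_signs_exp_overlap_le [Nonempty K] {a : ℝ} (ha0 : 0 ≤ a) (ha : a < 1)
    (hu : ∀ x k, u x k ^ 2 = 1) (x y : Fin N → X) :
    ∑ e : Fin N → Bool, Real.exp (a / N * ∑ p : Pairs N, sgn (e p.1.1) * sgn (e p.1.2) *
      (overlap u (x p.1.1) (x p.1.2) * overlap u (y p.1.1) (y p.1.2)))
      ≤ 2 ^ N * gaussConst a := by
  have hs : ∀ b, sgn b * sgn b = 1 := fun b => by cases b <;> simp [sgn]
  set n : ℝ := (Fintype.card K : ℝ) with hn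
  have hn0 : 0 < n := by simp [hn, Fintype.card_pos]
  have h1 : ∀ e : Fin N → Bool,
      Real.exp (a / N * ∑ p : Pairs N, sgn (e p.1.1) * sgn (e p.1.2) *
        (overlap u (x p.1.1) (x p.1.2) * overlap u (y p.1.1) (y p.1.2)))
      ≤ ∑ kl : K × K, (1 / n ^ 2) * Real.exp (a / (2 * N) *
        (∑ i, sgn (e i) * (u (x i) kl.1 * u (y i) kl.2)) ^ 2) := by
    intro e
    have hJ := convexOn_exp.map_sum_le (t := Finset.univ) (w := fun _ : K × K => 1 / n ^ 2)
      (p := fun kl => a / (2 * N) * (∑ i, sgn (e i) * (u (x i) kl.1 * u (y i) kl.2)) ^ 2)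
      (fun _ _ => by positivity) (by
        simp only [Finset.sum_const, Finset.card_univ, Fintype.card_prod, nsmul_eq_mul,
          Nat.cast_mul, ← hn]
        field_simp) (fun _ _ => Set.mem_univ _)
    simp only [smul_eq_mul] at hJ
    refine le_trans (Real.exp_le_exp.2 ?_) hJ
    rw [sum_pairs (fun i j => sgn (e i) * sgn (e j) *
      (overlap u (x i) (x j) * overlap u (y i) (y j))) (fun i j => by
        rw [overlap_comm (x i), overlap_comm (y i), mul_comm (sgn _)]),
      sum_overlap_mul_overlap (fun i => sgn (e i)), ← Finset.mul_sum, ← Finset.mul_sum,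
      Fintype.sum_prod_type, ← hn]
    have h0 : 0 ≤ ∑ i, sgn (e i) * sgn (e i) *
        (overlap u (x i) (x i) * overlap u (y i) (y i)) :=
      Finset.sum_nonneg fun i _ => by simp [hs, overlap_self hu]
    set T := ∑ k, ∑ l, (∑ i, sgn (e i) * (u (x i) k * u (y i) l)) ^ 2
    calc _ ≤ a / N * ((T / n ^ 2) / 2) := by gcongr; linarith
      _ = _ := by rw [mul_comm 2 (N : ℝ), ← div_div a]; ring
  refine (Finset.sum_le_sum fun e _ => h1 e).trans ?_
  rw [Finset.sum_comm]
  simp only [← Finset.mul_sum]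
  have h2 : ∀ kl : K × K, ∑ e : Fin N → Bool, Real.exp (a / (2 * N) *
      (∑ i, sgn (e i) * (u (x i) kl.1 * u (y i) kl.2)) ^ 2) ≤ 2 ^ N * gaussConst a := fun kl =>
    sum_signs_exp_sq_le ha0 ha _ fun i => by rw [mul_pow, hu, hu, one_mul]
  calc _ ≤ 1 / n ^ 2 * ∑ _kl : K × K, 2 ^ N * gaussConst a := by
        gcongr with kl _; exact h2 kl
    _ = _ := by
      simp only [Finset.sum_const, Finset.card_univ, Fintype.card_prod, nsmul_eq_mul,
          Nat.cast_mul, ← hn]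
      field_simp

variable [Fintype X]

theorem integral_pathZ (c : ℝ) : ∫ J, pathZ w u c J ∂(stdGauss (Pairs N)) =
    ∑ x : Fin N → X, (∏ i, w (x i)) *
      Real.exp (c ^ 2 / 2 * ∑ p : Pairs N, overlap u (x p.1.1) (x p.1.2) ^ 2) := by
  unfold pathZ
  rw [integral_finsetSum _ fun x _ => (integrable_exp_stdGauss _).const_mul _]
  refine Finset.sum_congr rfl fun x _ => ?_
  rw [integral_const_mul, integral_exp_stdGauss, Finset.sum_div, Finset.mul_sum]
  congr 3 with p
  ring

theorem integral_pathZ_sq (c : ℝ) : ∫ J, pathZ w u c J ^ 2 ∂(stdGauss (Pairs N)) =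
    ∑ x : Fin N → X, ∑ y : Fin N → X,
      ((∏ i, w (x i)) * Real.exp (c ^ 2 / 2 * ∑ p : Pairs N, overlap u (x p.1.1) (x p.1.2) ^ 2)) *
      ((∏ i, w (y i)) * Real.exp (c ^ 2 / 2 * ∑ p : Pairs N, overlap u (y p.1.1) (y p.1.2) ^ 2)) *
      Real.exp (c ^ 2 * ∑ p : Pairs N,
        overlap u (x p.1.1) (x p.1.2) * overlap u (y p.1.1) (y p.1.2)) := by
  have h1 : ∀ J : Pairs N → ℝ, pathZ w u c J ^ 2 = ∑ x : Fin N → X, ∑ y : Fin N → X,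
      ((∏ i, w (x i)) * ∏ i, w (y i)) * Real.exp (∑ p : Pairs N,
        c * (overlap u (x p.1.1) (x p.1.2) + overlap u (y p.1.1) (y p.1.2)) * J p) := fun J => by
    rw [sq, pathZ, Finset.sum_mul_sum]
    refine Finset.sum_congr rfl fun x _ => Finset.sum_congr rfl fun y _ => ?_
    rw [mul_mul_mul_comm, ← Real.exp_add, ← Finset.sum_add_distrib]
    congr 3 with p
    ring
  simp only [h1]
  rw [integral_finsetSum _ fun x _ => integrable_finsetSum _ fun y _ =>
    (integrable_exp_stdGauss _).const_mul _]
  refine Finset.sum_congr rfl fun x _ => ?_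
  rw [integral_finsetSum _ fun y _ => (integrable_exp_stdGauss _).const_mul _]
  refine Finset.sum_congr rfl fun y _ => ?_
  rw [integral_const_mul, integral_exp_stdGauss, mul_mul_mul_comm (∏ i, w (x i)) (Real.exp _),
    mul_assoc (_ * _) (_ * _), ← Real.exp_add, ← Real.exp_add, Finset.sum_div]
  congr 2
  simp only [Finset.mul_sum, ← Finset.sum_add_distrib]
  refine Finset.sum_congr rfl fun p _ => ?_
  ring

/-- The second moment bound: the weights are invariant under the global flip `τ` of each single
path, so the interaction of the two replicas may be averaged over independent flips. -/
theorem integral_pathZ_sq_le [Nonempty K] {a c : ℝ} (ha0 : 0 ≤ a) (ha : a < 1)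
    (hc : c ^ 2 = a / N) (hu : ∀ x k, u x k ^ 2 = 1) (hw : ∀ x, 0 ≤ w x) (τ : Equiv.Perm X)
    (hτw : ∀ x, w (τ x) = w x) (hτu : ∀ x k, u (τ x) k = -u x k) :
    ∫ J, pathZ w u c J ^ 2 ∂(stdGauss (Pairs N))
      ≤ gaussConst a * (∫ J, pathZ w u c J ∂(stdGauss (Pairs N))) ^ 2 := by
  rw [integral_pathZ_sq, integral_pathZ]
  set F : (Fin N → X) → ℝ := fun x => (∏ i, w (x i)) *
    Real.exp (c ^ 2 / 2 * ∑ p : Pairs N, overlap u (x p.1.1) (x p.1.2) ^ 2) with hF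
  have hF0 : ∀ x, 0 ≤ F x := fun x =>
    mul_nonneg (Finset.prod_nonneg fun i _ => hw _) (Real.exp_nonneg _)
  set G : (Fin N → X) → (Fin N → X) → ℝ := fun x y => ∑ p : Pairs N,
        overlap u (x p.1.1) (x p.1.2) * overlap u (y p.1.1) (y p.1.2) with hG
  -- `fl b` flips a single path when `b` is true; `Φ e` flips the sites selected by `e`.
  let fl : Bool → Equiv.Perm X := fun b => if b then τ else Equiv.refl X
  have hflw : ∀ b x, w (fl b x) = w x := fun b x => by cases b <;> simp [fl, hτw]
  have hflu : ∀ b x k, u (fl b x) k = sgn b * u x k := fun b x k => by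
    cases b <;> simp [fl, hτu, sgn]
  have hflo : ∀ b b' x y, overlap u (fl b x) (fl b' y) = sgn b * sgn b' * overlap u x y := by
    intro b b' x y
    rw [overlap, overlap, ← mul_div_assoc, Finset.mul_sum]
    simp only [hflu, mul_mul_mul_comm]
  have hsq : ∀ b, sgn b ^ 2 = 1 := fun b => by cases b <;> simp [sgn]
  let Φ : (Fin N → Bool) → Equiv.Perm (Fin N → X) := fun e => Equiv.piCongrRight fun i => fl (e i)
  have hΦF : ∀ e x, F (Φ e x) = F x := fun e x => by
    simp only [hF, Φ, Equiv.piCongrRight_apply, Pi.map_apply, hflw, hflo, mul_pow, hsq, one_mul]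
  have hΦG : ∀ e x y, G (Φ e x) y = ∑ p : Pairs N, sgn (e p.1.1) * sgn (e p.1.2) *
      (overlap u (x p.1.1) (x p.1.2) * overlap u (y p.1.1) (y p.1.2)) := fun e x y => by
    simp only [hG, Φ, Equiv.piCongrRight_apply, Pi.map_apply, hflo, mul_assoc]
  have key : ∀ e, ∑ x, ∑ y, F x * F y * Real.exp (c ^ 2 * G x y)
      = ∑ x, ∑ y, F x * F y * Real.exp (c ^ 2 * G (Φ e x) y) := fun e => by
    rw [← Equiv.sum_comp (Φ e)]
    simp only [hΦF]
  have h2 : (2 : ℝ) ^ N * ∑ x, ∑ y, F x * F y * Real.exp (c ^ 2 * G x y)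
      = ∑ x, ∑ y, F x * F y * ∑ e, Real.exp (c ^ 2 * G (Φ e x) y) := by
    have : ∑ _e : Fin N → Bool, ∑ x, ∑ y, F x * F y * Real.exp (c ^ 2 * G x y)
        = 2 ^ N * ∑ x, ∑ y, F x * F y * Real.exp (c ^ 2 * G x y) := by simp
    rw [← this, Finset.sum_congr rfl fun e _ => key e, Finset.sum_comm]
    refine Finset.sum_congr rfl fun x _ => ?_
    rw [Finset.sum_comm]
    simp only [Finset.mul_sum]
  have h3 : ∑ x, ∑ y, F x * F y * ∑ e, Real.exp (c ^ 2 * G (Φ e x) y)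
      ≤ ∑ x, ∑ y, F x * F y * (2 ^ N * gaussConst a) := by
    refine Finset.sum_le_sum fun x _ => Finset.sum_le_sum fun y _ =>
      mul_le_mul_of_nonneg_left ?_ (mul_nonneg (hF0 x) (hF0 y))
    simp only [hΦG, hc]
    exact sum_signs_exp_overlap_le ha0 ha hu x y
  refine le_of_mul_le_mul_left (a := (2 : ℝ) ^ N) ?_ (by positivity)
  rw [h2]
  refine h3.trans_eq ?_
  rw [sq, Finset.sum_mul_sum]
  simp only [← Finset.sum_mul]
  ring

/-! ### Subadditivity of the annealed free energy -/

/-- The factor `exp (-a / 4)` removes the diagonal terms `i = j`, whose overlaps are `1`. -/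
theorem integral_pathZ_eq_pathA [Nonempty K] {a c : ℝ} (hN : N ≠ 0) (hc : c ^ 2 = a / N)
    (hu : ∀ x k, u x k ^ 2 = 1) :
    ∫ J, pathZ w u c J ∂(stdGauss (Pairs N)) = Real.exp (-a / 4) * pathA w u a N := by
  rw [integral_pathZ, pathA, Finset.mul_sum]
  refine Finset.sum_congr rfl fun x _ => ?_
  rw [mul_left_comm, ← Real.exp_add,
    sum_pairs (fun i j => overlap u (x i) (x j) ^ 2) fun i j => by rw [overlap_comm], hc]
  have hN' : (N : ℝ) ≠ 0 := by exact_mod_cast hN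
  simp only [overlap_self hu, one_pow, Finset.sum_const, Finset.card_univ, Fintype.card_fin,
    nsmul_eq_mul, mul_one]
  congr 2
  field_simp
  ring

/-- The exponent of `pathA` is `N` times a convex function of the empirical mean over the sites,
so it is subadditive in the system size. -/
theorem pathA_add_le {a : ℝ} (ha0 : 0 ≤ a) (hw : ∀ x, 0 ≤ w x) {M N : ℕ} (hM : M ≠ 0)
    (hN : N ≠ 0) : pathA w u a (M + N) ≤ pathA w u a M * pathA w u a N := by
  have hM' : (0 : ℝ) < M := by positivity
  have hN' : (0 : ℝ) < N := by positivity
  rw [pathA, pathA, pathA, Finset.sum_mul_sum, ← (Fin.appendEquiv M N).sum_comp,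
    Fintype.sum_prod_type]
  refine Finset.sum_le_sum fun x _ => Finset.sum_le_sum fun y _ => ?_
  rw [mul_mul_mul_comm, ← Real.exp_add]
  simp only [sum_overlap_sq]
  simp only [Fin.appendEquiv, Equiv.coe_fn_mk, Fin.prod_univ_add, Fin.append_left,
    Fin.append_right, Fin.sum_univ_add]
  refine mul_le_mul_of_nonneg_left (Real.exp_le_exp.2 ?_)
    (mul_nonneg (Finset.prod_nonneg fun i _ => hw _) (Finset.prod_nonneg fun i _ => hw _))
  rw [← mul_add]
  refine mul_le_mul_of_nonneg_left ?_ (by positivity)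
  rw [div_right_comm, div_right_comm _ _ (M : ℝ), div_right_comm _ _ (N : ℝ), ← add_div]
  refine div_le_div_of_nonneg_right ?_ (sq_nonneg (Fintype.card K : ℝ))
  simp only [Finset.sum_div, ← Finset.sum_add_distrib]
  refine Finset.sum_le_sum fun k _ => Finset.sum_le_sum fun l _ => ?_
  push_cast
  simpa [Fin.sum_univ_two] using Finset.sq_sum_div_le_sum_sq_div Finset.univ
    ![∑ i, u (x i) k * u (x i) l, ∑ i, u (y i) k * u (y i) l] (g := ![(M : ℝ), N])
    (by simp [Fin.forall_fin_two, hM', hN'])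

theorem pow_le_pathA {a : ℝ} (ha0 : 0 ≤ a) (hw : ∀ x, 0 ≤ w x) :
    (∑ x, w x) ^ N ≤ pathA w u a N := by
  rw [Finset.sum_pow', pathA, Fintype.piFinset_univ]
  refine Finset.sum_le_sum fun x _ => le_mul_of_one_le_right
    (Finset.prod_nonneg fun i _ => hw _) (Real.one_le_exp ?_)
  positivity

end Path

/-! ### Variance of Lipschitz functions of independent Gaussian variables -/

section Variance
variable {ι : Type*} [Fintype ι] {c : ℝ}

theorem continuous_of_abs_sub_le {f : (ι → ℝ) → ℝ}
    (hf : ∀ x y, |f x - f y| ≤ c * ∑ p, |x p - y p|) : Continuous f := by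
  rw [continuous_iff_continuousAt]
  intro y
  rw [ContinuousAt, tendsto_iff_norm_sub_tendsto_zero]
  refine squeeze_zero (fun _ => norm_nonneg _) (fun x => hf x y) ?_
  have : Continuous fun x : ι → ℝ => c * ∑ p, |x p - y p| := by fun_prop
  simpa using this.tendsto y

theorem memLp_two_of_abs_sub_le {f : (ι → ℝ) → ℝ}
    (hf : ∀ x y, |f x - f y| ≤ c * ∑ p, |x p - y p|) : MemLp f 2 (stdGauss ι) := by
  have h0 : ∀ p, MemLp (fun x : ι → ℝ => x p) 2 (stdGauss ι) := fun p =>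
    (memLp_id_gaussianReal' (μ := 0) (v := 1) 2 (by simp)).comp_measurePreserving
      (measurePreserving_eval (fun _ : ι => gaussianReal 0 1) p)
  have h1 : MemLp (fun x : ι → ℝ => ∑ p, |x p|) 2 (stdGauss ι) :=
    memLp_finsetSum _ fun p _ => (h0 p).abs
  have h2 : MemLp (fun x : ι → ℝ => |f 0| + c * ∑ p, |x p|) 2 (stdGauss ι) := by
    have h := h1.const_mul c
    have h' : MemLp (fun _ : ι → ℝ => |f 0|) 2 (stdGauss ι) := memLp_const |f 0|
    exact MemLp.add h' h
  have hcont := continuous_of_abs_sub_le hf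
  refine h2.mono' hcont.aestronglyMeasurable (.of_forall fun x => ?_)
  have h3 : |f x - f 0| ≤ c * ∑ p, |x p| := by simpa only [Pi.zero_apply, sub_zero] using hf x 0
  have h4 := abs_sub_abs_le_abs_sub (f x) (f 0)
  rw [Real.norm_eq_abs]
  linarith

theorem integrable_of_abs_sub_le {f : (ι → ℝ) → ℝ}
    (hf : ∀ x y, |f x - f y| ≤ c * ∑ p, |x p - y p|) : Integrable f (stdGauss ι) :=
  (memLp_two_of_abs_sub_le hf).integrable one_le_two

theorem integrable_sub_sq_of_abs_sub_le {f : (ι → ℝ) → ℝ}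
    (hf : ∀ x y, |f x - f y| ≤ c * ∑ p, |x p - y p|) (m : ℝ) :
    Integrable (fun x => (f x - m) ^ 2) (stdGauss ι) :=
  ((memLp_two_of_abs_sub_le hf).sub (memLp_const m)).integrable_sq

/-- Second moment about `m` of a Lipschitz function of one Gaussian variable: among all centres
the mean gives the least second moment, which is compared with the one about `h 0`. -/
theorem integral_gaussianReal_sub_sq_le {h : ℝ → ℝ} (hh : ∀ x y, |h x - h y| ≤ c * |x - y|)
    (m : ℝ) : ∫ x, (h x - m) ^ 2 ∂(gaussianReal 0 1)
      ≤ c ^ 2 + ((∫ x, h x ∂(gaussianReal 0 1)) - m) ^ 2 := by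
  have hid : MemLp (fun x : ℝ => x) 2 (gaussianReal 0 1) := memLp_id_gaussianReal' 2 (by simp)
  have hcont : Continuous h := by
    rw [continuous_iff_continuousAt]
    intro y
    rw [ContinuousAt, tendsto_iff_norm_sub_tendsto_zero]
    refine squeeze_zero (fun _ => norm_nonneg _) (fun x => hh x y) ?_
    have : Continuous fun x : ℝ => c * |x - y| := by fun_prop
    simpa using this.tendsto y
  have hL : MemLp (fun x => h x - h 0) 2 (gaussianReal 0 1) := by
    refine (hid.abs.const_mul c).mono' (by fun_prop) (.of_forall fun x => ?_)
    simpa using hh x 0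
  have hsq := hL.integrable_sq
  have hint := hL.integrable one_le_two
  have hint' : Integrable h (gaussianReal 0 1) := by
    exact (hint.add (integrable_const (h 0))).congr (.of_forall fun x => sub_add_cancel _ _)
  have e1 : ∫ x, (h x - h 0) ∂(gaussianReal 0 1) = (∫ x, h x ∂(gaussianReal 0 1)) - h 0 := by
    rw [integral_sub hint' (integrable_const _)]
    simp
  have e2 : ∫ x, (h x - m) ^ 2 ∂(gaussianReal 0 1) = (∫ x, (h x - h 0) ^ 2 ∂(gaussianReal 0 1))
      + 2 * (h 0 - m) * ((∫ x, h x ∂(gaussianReal 0 1)) - h 0) + (h 0 - m) ^ 2 := by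
    have : (fun x => (h x - m) ^ 2)
        = fun x => (h x - h 0) ^ 2 + 2 * (h 0 - m) * (h x - h 0) + (h 0 - m) ^ 2 := by
      funext x
      ring
    have hadd : Integrable (fun x => (h x - h 0) ^ 2 + 2 * (h 0 - m) * (h x - h 0))
        (gaussianReal 0 1) := hsq.add (hint.const_mul _)
    rw [this, integral_add hadd (integrable_const _), integral_add hsq (hint.const_mul _),
      integral_const_mul, e1]
    simp
  have e3 : ∫ x, x ^ 2 ∂(gaussianReal 0 1) = 1 := by
    have h1 := variance_id_gaussianReal (μ := 0) (v := 1)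
    rw [variance_eq_integral aemeasurable_id] at h1
    simpa using h1
  have e4 : ∫ x, (h x - h 0) ^ 2 ∂(gaussianReal 0 1) ≤ c ^ 2 := by
    calc _ ≤ ∫ x, c ^ 2 * x ^ 2 ∂(gaussianReal 0 1) := by
          refine integral_mono hsq (hid.integrable_sq.const_mul _) fun x => ?_
          have := hh x 0
          rw [sub_zero] at this
          have h2 := pow_le_pow_left₀ (abs_nonneg _) this 2
          rwa [mul_pow, sq_abs, sq_abs] at h2
      _ = c ^ 2 := by rw [integral_const_mul, e3, mul_one]
  rw [e2]
  nlinarith [sq_nonneg ((∫ x, h x ∂(gaussianReal 0 1)) - h 0)]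

/-- The variables are integrated out one at a time: the mean over the first variable is again
`c`-Lipschitz in each of the others. -/
theorem variance_le_fin {n : ℕ} {f : (Fin n → ℝ) → ℝ}
    (hf : ∀ x y, |f x - f y| ≤ c * ∑ p, |x p - y p|) :
    ∫ x, (f x - ∫ y, f y ∂(stdGauss (Fin n))) ^ 2 ∂(stdGauss (Fin n)) ≤ n * c ^ 2 := by
  induction n with
  | zero =>
    have : ∀ x, f x = f 0 := fun x => congrArg f (Subsingleton.elim _ _)
    simp [this]
  | succ n ih =>
    have he := (measurePreserving_piFinSuccAbove (fun _ : Fin (n + 1) => gaussianReal 0 1) 0).symm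
    have hez : ∀ z : ℝ × (Fin n → ℝ), (MeasurableEquiv.piFinSuccAbove
        (fun _ : Fin (n + 1) => ℝ) 0).symm z = Fin.cons z.1 z.2 := fun z =>
      Fin.insertNth_zero' z.1 z.2
    have hcons : ∀ g : (Fin (n + 1) → ℝ) → ℝ, ∫ x, g x ∂(stdGauss (Fin (n + 1)))
        = ∫ z : ℝ × (Fin n → ℝ), g (Fin.cons z.1 z.2)
          ∂((gaussianReal 0 1).prod (stdGauss (Fin n))) := fun g => by
      rw [← he.integral_comp' g]
      simp only [hez]
    have hint : ∀ g : (Fin (n + 1) → ℝ) → ℝ, Integrable g (stdGauss (Fin (n + 1))) →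
        Integrable (fun z : ℝ × (Fin n → ℝ) => g (Fin.cons z.1 z.2))
          ((gaussianReal 0 1).prod (stdGauss (Fin n))) := fun g hg => by
      have := (he.integrable_comp_emb (MeasurableEquiv.measurableEmbedding _)).2 hg
      exact this.congr (.of_forall fun z => congrArg g (hez z))
    have h1 : ∀ y a a', |f (Fin.cons a y) - f (Fin.cons a' y)| ≤ c * |a - a'| := fun y a a' => by
      simpa [Fin.sum_univ_succ] using hf (Fin.cons a y) (Fin.cons a' y)
    have h2 : ∀ a y y', |f (Fin.cons a y) - f (Fin.cons a y')| ≤ c * ∑ p, |y p - y' p| :=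
      fun a y y' => by
        simpa [Fin.sum_univ_succ] using hf (Fin.cons a y) (Fin.cons a y')
    have h1i : ∀ y, Integrable (fun a => f (Fin.cons a y)) (gaussianReal 0 1) := fun y => by
      have hid : MemLp (fun x : ℝ => x) 2 (gaussianReal 0 1) := memLp_id_gaussianReal' 2 (by simp)
      have hc := (continuous_of_abs_sub_le hf)
      have := (hid.integrable one_le_two).abs
      refine ((this.const_mul c).add (integrable_const |f (Fin.cons 0 y)|)).mono'
        (hc.comp (by fun_prop)).aestronglyMeasurable (.of_forall fun a => ?_)
      have h3 := h1 y a 0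
      rw [sub_zero] at h3
      rw [Real.norm_eq_abs, Pi.add_apply]
      linarith [abs_sub_abs_le_abs_sub (f (Fin.cons a y)) (f (Fin.cons 0 y))]
    set F : (Fin n → ℝ) → ℝ := fun y => ∫ a, f (Fin.cons a y) ∂(gaussianReal 0 1) with hF
    have hFL : ∀ y y', |F y - F y'| ≤ c * ∑ p, |y p - y' p| := fun y y' => by
      rw [hF, ← integral_sub (h1i y) (h1i y')]
      refine (abs_integral_le_integral_abs).trans ?_
      calc _ ≤ ∫ _a, c * ∑ p, |y p - y' p| ∂(gaussianReal 0 1) :=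
            integral_mono ((h1i y).sub (h1i y')).abs (integrable_const _) fun a => h2 a y y'
        _ = _ := by simp
    have hm : ∫ x, f x ∂(stdGauss (Fin (n + 1))) = ∫ y, F y ∂(stdGauss (Fin n)) := by
      rw [hcons, integral_prod_symm _ (hint f (integrable_of_abs_sub_le hf))]
    rw [hm, hcons, integral_prod_symm _ (hint _ (integrable_sub_sq_of_abs_sub_le hf _))]
    set m := ∫ y, F y ∂(stdGauss (Fin n))
    calc _ ≤ ∫ y, (c ^ 2 + (F y - m) ^ 2) ∂(stdGauss (Fin n)) := by
          refine integral_mono (hint _ (integrable_sub_sq_of_abs_sub_le hf m)).integral_prod_right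
            ((integrable_const _).add (integrable_sub_sq_of_abs_sub_le hFL m)) fun y => ?_
          exact integral_gaussianReal_sub_sq_le (h1 y) m
      _ = c ^ 2 + ∫ y, (F y - m) ^ 2 ∂(stdGauss (Fin n)) := by
          rw [integral_add (integrable_const _) (integrable_sub_sq_of_abs_sub_le hFL m)]
          simp
      _ ≤ _ := by
          have := ih hFL
          push_cast
          linarith

/-- Efron–Stein bound: the variance of a function of independent standard Gaussian variables
that is `c`-Lipschitz in each variable is at most `c ^ 2` times the number of variables. -/
theorem variance_le {f : (ι → ℝ) → ℝ} (hf : ∀ x y, |f x - f y| ≤ c * ∑ p, |x p - y p|) :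
    ∫ x, (f x - ∫ y, f y ∂(stdGauss ι)) ^ 2 ∂(stdGauss ι) ≤ Fintype.card ι * c ^ 2 := by
  let e := (Fintype.equivFin ι).symm
  have hcomp : ∀ g : (ι → ℝ) → ℝ, ∫ x, g x ∂(stdGauss ι)
      = ∫ x, g (fun i => x (e.symm i)) ∂(stdGauss (Fin (Fintype.card ι))) := fun g => by
    have := (measurePreserving_piCongrLeft (fun _ : ι => gaussianReal 0 1) e).integral_comp' g
    rw [← this]
    refine integral_congr_ae (.of_forall fun x => congrArg g (funext fun i => ?_))
    obtain ⟨j, rfl⟩ := e.surjective i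
    simp [MeasurableEquiv.piCongrLeft]
  rw [hcomp, hcomp]
  refine variance_le_fin fun x y => (hf _ _).trans_eq ?_
  congr 1
  exact e.symm.sum_comp fun i => |x i - y i|

end Variance

/-! ### The Trotter product formula -/

theorem norm_pow_sub_pow_le {𝔸 : Type*} [NormedRing 𝔸] [NormOneClass 𝔸] {x y : 𝔸} {M : ℝ}
    (hM : 1 ≤ M) (hx : ‖x‖ ≤ M) (hy : ‖y‖ ≤ M) (n : ℕ) :
    ‖x ^ n - y ^ n‖ ≤ M ^ n * (n * ‖x - y‖) := by
  induction n with
  | zero => simp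
  | succ n ih =>
    have h : x ^ (n + 1) - y ^ (n + 1) = x * (x ^ n - y ^ n) + (x - y) * y ^ n := by
      rw [pow_succ', pow_succ']; noncomm_ring
    have h1 : ‖x * (x ^ n - y ^ n)‖ ≤ M * (M ^ n * (n * ‖x - y‖)) :=
      (norm_mul_le _ _).trans (mul_le_mul hx ih (norm_nonneg _) (by linarith))
    have h2 : ‖(x - y) * y ^ n‖ ≤ ‖x - y‖ * M ^ n :=
      (norm_mul_le _ _).trans (mul_le_mul_of_nonneg_left
        ((norm_pow_le _ _).trans (pow_le_pow_left₀ (norm_nonneg _) hy n)) (norm_nonneg _))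
    have h3 : ‖x - y‖ * M ^ n ≤ ‖x - y‖ * M ^ (n + 1) :=
      mul_le_mul_of_nonneg_left (pow_le_pow_right₀ hM n.le_succ) (norm_nonneg _)
    rw [h]
    refine (norm_add_le _ _).trans ((add_le_add h1 (h2.trans h3)).trans_eq ?_)
    push_cast
    ring

theorem tendsto_nsmul_sub_of_hasDerivAt {E : Type*} [NormedAddCommGroup E] [NormedSpace ℝ E]
    {f : ℝ → E} {f' : E} (hf : HasDerivAt f f' 0) :
    Tendsto (fun n : ℕ => (n : ℝ) • (f (1 / n) - f 0)) atTop (𝓝 f') := by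
  have h := hf.tendsto_slope_zero
  have h1 : Tendsto (fun n : ℕ => (1 : ℝ) / n) atTop (𝓝[≠] 0) := by
    rw [tendsto_nhdsWithin_iff]
    refine ⟨tendsto_one_div_atTop_nhds_zero_nat, ?_⟩
    filter_upwards [eventually_gt_atTop 0] with n hn
    simp [hn.ne']
  refine (h.comp h1).congr fun n => ?_
  simp

/-- The `n`-th powers of a sequence `1 + C / n + o(1 / n)` converge to `exp C`. -/
theorem tendsto_pow_exp {𝔸 : Type*} [NormedRing 𝔸] [NormedAlgebra ℝ 𝔸] [NormOneClass 𝔸]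
    [CompleteSpace 𝔸] {p : ℕ → 𝔸} {C : 𝔸}
    (hp : Tendsto (fun n : ℕ => (n : ℝ) • (p n - 1)) atTop (𝓝 C)) :
    Tendsto (fun n => p n ^ n) atTop (𝓝 (NormedSpace.exp C)) := by
  let q : ℕ → 𝔸 := fun n => NormedSpace.exp ((1 / (n : ℝ)) • C)
  have hq : Tendsto (fun n : ℕ => (n : ℝ) • (q n - 1)) atTop (𝓝 C) := by
    have h := tendsto_nsmul_sub_of_hasDerivAt (hasDerivAt_exp_smul_const (𝕂 := ℝ) C 0)
    simpa [q] using h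
  have hqn : ∀ᶠ n in atTop, q n ^ n = NormedSpace.exp C := by
    filter_upwards [eventually_gt_atTop 0] with n hn
    have hn' : (n : ℝ) ≠ 0 := by positivity
    let _ : NormedAlgebra ℚ 𝔸 := NormedAlgebra.restrictScalars ℚ ℝ 𝔸
    rw [← NormedSpace.exp_nsmul, ← Nat.cast_smul_eq_nsmul ℝ, smul_smul, mul_one_div_cancel hn',
      one_smul]
  have hbound : ∀ r : ℕ → 𝔸, Tendsto (fun n : ℕ => (n : ℝ) • (r n - 1)) atTop (𝓝 C) →
      ∀ᶠ n : ℕ in atTop, ‖r n‖ ≤ Real.exp ((‖C‖ + 1) / n) := fun r hr => by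
    filter_upwards [hr.norm.eventually_lt_const (lt_add_one ‖C‖), eventually_gt_atTop 0]
      with n hn hn0
    have hn' : (0 : ℝ) < n := by exact_mod_cast hn0
    rw [norm_smul, Real.norm_of_nonneg hn'.le] at hn
    have h1 : ‖r n - 1‖ ≤ (‖C‖ + 1) / n := by rw [le_div_iff₀ hn']; linarith
    have h2 : ‖r n‖ ≤ ‖r n - 1‖ + 1 := by simpa using norm_add_le (r n - 1) 1
    linarith [Real.add_one_le_exp ((‖C‖ + 1) / n)]
  have hdiff : Tendsto (fun n => p n ^ n - q n ^ n) atTop (𝓝 0) := by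
    have h0 : Tendsto (fun n : ℕ => Real.exp (‖C‖ + 1) *
        ‖(n : ℝ) • (p n - 1) - (n : ℝ) • (q n - 1)‖) atTop (𝓝 0) := by
      simpa using ((hp.sub hq).norm).const_mul (Real.exp (‖C‖ + 1))
    refine squeeze_zero_norm' ?_ h0
    filter_upwards [hbound p hp, hbound q hq, eventually_gt_atTop 0] with n h1 h2 hn
    have hn' : (0 : ℝ) < n := by exact_mod_cast hn
    have h3 := norm_pow_sub_pow_le (Real.one_le_exp (by positivity)) h1 h2 n
    have h4 : (n : ℝ) * ‖p n - q n‖ = ‖(n : ℝ) • (p n - 1) - (n : ℝ) • (q n - 1)‖ := by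
      rw [← smul_sub, sub_sub_sub_cancel_right, norm_smul, Real.norm_of_nonneg hn'.le]
    rwa [← Real.exp_nat_mul, mul_div_cancel₀ _ hn'.ne', h4] at h3
  have := hdiff.add (tendsto_const_nhds (x := NormedSpace.exp C))
  rw [zero_add] at this
  refine this.congr' ?_
  filter_upwards [hqn] with n hn
  rw [hn, sub_add_cancel]

section MatrixPower
variable {S R : Type*} [Fintype S] [DecidableEq S] [CommSemiring R]

theorem pow_apply_eq_sum_paths (M : Matrix S S R) (n : ℕ) (s t : S) :
    (M ^ n) s t = ∑ p : Fin (n + 1) → S, if p 0 = s ∧ p (Fin.last n) = t then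
      ∏ k : Fin n, M (p k.castSucc) (p k.succ) else 0 := by
  induction n generalizing s with
  | zero =>
    rw [← (Equiv.funUnique (Fin 1) S).symm.sum_comp]
    simp only [pow_zero, Matrix.one_apply, Finset.univ_eq_empty, Finset.prod_empty]
    rw [Finset.sum_eq_single s] <;> simp +contextual
  | succ n ih =>
    rw [pow_succ', Matrix.mul_apply, ← (Fin.consEquiv fun _ => S).sum_comp, Fintype.sum_prod_type]
    simp only [ih, Finset.mul_sum]
    rw [Finset.sum_comm]
    conv_rhs => rw [Finset.sum_comm]
    refine Finset.sum_congr rfl fun p _ => ?_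
    simp only [Fin.consEquiv_apply, Fin.cons_zero, Fin.prod_univ_succ, Fin.castSucc_zero,
      Fin.cons_succ, ← Fin.succ_last, ← Fin.succ_castSucc]
    rw [Finset.sum_eq_single (p 0), Finset.sum_eq_single s]
    · simp
    · intro a _ ha; simp [ha]
    · simp
    · intro a _ ha; simp [ha.symm]
    · simp

theorem trace_pow_eq_sum_paths (M : Matrix S S R) (n : ℕ) :
    (M ^ n).trace = ∑ p : Fin (n + 1) → S, if p 0 = p (Fin.last n) then
      ∏ k : Fin n, M (p k.castSucc) (p k.succ) else 0 := by
  simp only [Matrix.trace, Matrix.diag_apply, pow_apply_eq_sum_paths]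
  rw [Finset.sum_comm]
  refine Finset.sum_congr rfl fun p _ => ?_
  rw [Finset.sum_eq_single (p 0)]
  · simp [eq_comm]
  · intro a _ ha; simp [ha.symm]
  · simp

end MatrixPower

/-! ### Path representation of the partition function -/

/-- The eigenvalue of `S^z` at a basis vector. -/
def spin : Fin 2 → ℝ := ![1, -1]

/-- The entries of `1 + r S^x`. -/
def stepWeight (r : ℝ) (s t : Fin 2) : ℝ := if s = t then 1 else r

/-- The weight `∏ (1 + r S^x)` of a closed single-spin path with `n` steps; paths that are not
closed have weight `0`. -/
def pathWeight (r : ℝ) (n : ℕ) (x : Fin (n + 1) → Fin 2) : ℝ :=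
  if x 0 = x (Fin.last n) then ∏ k : Fin n, stepWeight r (x k.castSucc) (x k.succ) else 0

/-- The values `±1` of a single-spin path at the times `0, …, n - 1`. -/
def pathSpin (n : ℕ) (x : Fin (n + 1) → Fin 2) (k : Fin n) : ℝ := spin (x k.castSucc)

/-- The couplings that enter the Hamiltonian of `N` spins. -/
def coupling (N : ℕ) (J : ℕ → ℕ → ℝ) (p : Pairs N) : ℝ := J p.1.1 p.1.2

/-- The classical Ising energy `c ∑ J i j s i s j`. -/
def isingEnergy (c : ℝ) {N : ℕ} (J : Pairs N → ℝ) (s : Fin N → Fin 2) : ℝ :=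
  ∑ p : Pairs N, c * (spin (s p.1.1) * spin (s p.1.2)) * J p

/-- One Trotter step: the matrix `exp (x E) ∏ i (1 + x B S_i^x)` with `E` the diagonal matrix of
Ising energies. -/
def trotterStep (c B : ℝ) {N : ℕ} (J : Pairs N → ℝ) (x : ℝ) :
    Matrix (Fin N → Fin 2) (Fin N → Fin 2) ℝ :=
  Matrix.of fun s t => Real.exp (x * isingEnergy c J s) * ∏ i, stepWeight (x * B) (s i) (t i)

/-- The trace of a power of the Trotter step, expanded over closed paths of configurations, which
are the same as tuples of closed single-spin paths. -/
theorem trace_trotterStep_pow (c B : ℝ) {N : ℕ} (J : Pairs N → ℝ) (n : ℕ) :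
    (trotterStep c B J (1 / n) ^ n).trace = pathZ (pathWeight (B / n) n) (pathSpin n) c J := by
  rw [trace_pow_eq_sum_paths, pathZ,
    ← (Equiv.piComm fun (_ : Fin N) (_ : Fin (n + 1)) => Fin 2).sum_comp]
  refine Finset.sum_congr rfl fun x _ => ?_
  have hexp : ∑ k : Fin n, 1 / (n : ℝ) * isingEnergy c J (fun i => x i k.castSucc)
      = ∑ p : Pairs N, c * overlap (pathSpin n) (x p.1.1) (x p.1.2) * J p := by
    simp only [isingEnergy, Finset.mul_sum]
    rw [Finset.sum_comm]
    refine Finset.sum_congr rfl fun p _ => ?_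
    rw [overlap, Fintype.card_fin, mul_div_assoc', div_mul_eq_mul_div, Finset.mul_sum,
      Finset.sum_mul, Finset.sum_div]
    refine Finset.sum_congr rfl fun k _ => ?_
    simp only [pathSpin]
    ring
  have hw : ∏ i, pathWeight (B / n) n (x i) = if (∀ i, x i 0 = x i (Fin.last n)) then
      ∏ i, ∏ k : Fin n, stepWeight (B / n) (x i k.castSucc) (x i k.succ) else 0 := by
    simp only [pathWeight]
    rw [Finset.prod_ite_zero]
    simp
  rw [hw, ← hexp, Real.exp_sum]
  simp only [Equiv.piComm_apply, trotterStep, Matrix.of_apply, Function.swap, funext_iff]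
  split_ifs
  · rw [Finset.prod_mul_distrib, mul_comm, Finset.prod_comm]
    simp only [one_div_mul_eq_div]
    rfl
  · simp

theorem siteOperator_pauliX_apply {N : ℕ} (i : Fin N) (s t : Fin N → Fin 2) :
    siteOperator pauliX i s t = (((∏ j ∈ Finset.univ.erase i, stepWeight 0 (s j) (t j)) *
      (if s i = t i then 0 else 1) : ℝ) : ℂ) := by
  have hX : ∀ a c : Fin 2, pauliX a c = ((if a = c then 0 else 1 : ℝ) : ℂ) := by
    intro a c; fin_cases a <;> fin_cases c <;> simp [pauliX]
  rw [siteOperator, tensorMatrix, Matrix.of_apply, ← Finset.prod_erase_mul _ _ (Finset.mem_univ i),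
    Complex.ofReal_mul, Complex.ofReal_prod]
  simp only [Function.update_self, hX]
  congr 1
  refine Finset.prod_congr rfl fun j hj => ?_
  rw [Function.update_of_ne (Finset.ne_of_mem_erase hj), Matrix.one_apply, stepWeight]
  split_ifs <;> simp

theorem siteOperator_pauliZ {N : ℕ} (i : Fin N) :
    siteOperator pauliZ i = Matrix.diagonal fun s => ((spin (s i) : ℝ) : ℂ) := by
  have hZ : ∀ a c : Fin 2, pauliZ a c = if a = c then ((spin a : ℝ) : ℂ) else 0 := by
    intro a c; fin_cases a <;> fin_cases c <;> simp [pauliZ, spin]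
  ext s t
  rw [siteOperator, tensorMatrix, Matrix.of_apply]
  by_cases h : s = t
  · subst h
    rw [Matrix.diagonal_apply_eq, Finset.prod_eq_single i]
    · simp [hZ]
    · intro j _ hj
      simp [Function.update_of_ne hj]
    · simp
  · obtain ⟨k, hk⟩ := Function.ne_iff.1 h
    rw [Matrix.diagonal_apply_ne _ h]
    refine Finset.prod_eq_zero (Finset.mem_univ k) ?_
    by_cases hki : k = i
    · subst hki; simp [hZ, hk]
    · simp [Function.update_of_ne hki, hk]

theorem neg_smul_hamiltonian_apply (β v b : ℝ) (N : ℕ) (J : ℕ → ℕ → ℝ) (s t : Fin N → Fin 2) :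
    (-(β : ℂ) • hamiltonian v b N J) s t =
      (((if s = t then isingEnergy (β * v / √(N : ℝ)) (coupling N J) s else 0) +
        ∑ i, (∏ j ∈ Finset.univ.erase i, stepWeight 0 (s j) (t j)) *
          (if s i = t i then 0 else β * b) : ℝ) : ℂ) := by
  have hZ : (∑ i : Fin N, ∑ j ∈ Finset.Ioi i,
        ((J i j : ℝ) : ℂ) • (siteOperator pauliZ i * siteOperator pauliZ j)) s t
      = ((if s = t then ∑ p : Pairs N, spin (s p.1.1) * spin (s p.1.2) * coupling N J p
          else 0 : ℝ) : ℂ) := by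
    have hsum := sum_pairs_eq_sum_Ioi
      (fun i j : Fin N => spin (s i) * spin (s j) * J i j)
    simp only [siteOperator_pauliZ, Matrix.diagonal_mul_diagonal, Matrix.sum_apply,
      Matrix.smul_apply, Matrix.diagonal_apply, coupling]
    rw [hsum]
    split_ifs with h
    · push_cast
      refine Finset.sum_congr rfl fun i _ => Finset.sum_congr rfl fun j _ => ?_
      rw [smul_eq_mul]
      ring
    · simp
  rw [Matrix.smul_apply, hamiltonian, Matrix.sub_apply, Matrix.smul_apply, Matrix.smul_apply, hZ,
    Matrix.sum_apply]
  simp only [siteOperator_pauliX_apply, smul_eq_mul, isingEnergy]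
  rw [Complex.ofReal_add, mul_sub, sub_eq_add_neg]
  congr 1
  · rw [← Complex.ofReal_neg, ← Complex.ofReal_neg, ← Complex.ofReal_mul, ← Complex.ofReal_mul]
    congr 1
    split_ifs
    · rw [Finset.mul_sum, Finset.mul_sum]
      refine Finset.sum_congr rfl fun p _ => ?_
      ring
    · ring
  · rw [← Complex.ofReal_sum, ← Complex.ofReal_mul, ← Complex.ofReal_neg, ← Complex.ofReal_mul,
      ← Complex.ofReal_neg]
    congr 1
    rw [Finset.mul_sum, Finset.mul_sum, ← Finset.sum_neg_distrib]
    refine Finset.sum_congr rfl fun i _ => ?_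
    split_ifs <;> ring

theorem trotterStep_zero (c B : ℝ) {N : ℕ} (J : Pairs N → ℝ) : trotterStep c B J 0 = 1 := by
  ext s t
  simp only [trotterStep, Matrix.of_apply, zero_mul, Real.exp_zero, one_mul, stepWeight,
    Matrix.one_apply]
  rw [Finset.prod_ite_zero]
  simp [funext_iff]

theorem hasDerivAt_trotterStep (c B : ℝ) {N : ℕ} (J : Pairs N → ℝ) (s t : Fin N → Fin 2) :
    HasDerivAt (fun x => trotterStep c B J x s t)
      ((if s = t then isingEnergy c J s else 0) +
        ∑ i, (∏ j ∈ Finset.univ.erase i, stepWeight 0 (s j) (t j)) *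
          (if s i = t i then 0 else B)) 0 := by
  have h1 : HasDerivAt (fun x : ℝ => Real.exp (x * isingEnergy c J s)) (isingEnergy c J s) 0 := by
    simpa using ((hasDerivAt_id (0 : ℝ)).mul_const (isingEnergy c J s)).exp
  have h2 : ∀ i ∈ Finset.univ, HasDerivAt (fun x : ℝ => stepWeight (x * B) (s i) (t i))
      (if s i = t i then 0 else B) 0 := fun i _ => by
    simp only [stepWeight]
    split_ifs
    · exact hasDerivAt_const _ _
    · simpa using (hasDerivAt_id (0 : ℝ)).mul_const B
  have h3 := h1.mul (HasDerivAt.fun_finsetProd h2)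
  have h4 := congrFun (congrFun (trotterStep_zero c B J) s) t
  simp only [trotterStep, Matrix.of_apply, zero_mul, Real.exp_zero, one_mul,
    Matrix.one_apply] at h4
  refine h3.congr_deriv ?_
  simp only [zero_mul, Real.exp_zero, one_mul, smul_eq_mul, h4]
  split_ifs <;> simp

/-- The trace of `exp (-β H)` is the limit of partition functions of classical spin paths. With
`n = 0` steps the division `β b / n` is a junk value, irrelevant for the limit. -/
theorem tendsto_pathZ (β v b : ℝ) (N : ℕ) (J : ℕ → ℕ → ℝ) :
    Tendsto (fun n : ℕ => pathZ (pathWeight (β * b / n) n) (pathSpin n) (β * v / √(N : ℝ))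
      (coupling N J)) atTop (𝓝 (partitionFunction β v b N J)) := by
  -- The norm is auxiliary: the exponential depends only on the topology.
  let _ : NormedRing (Matrix (Fin N → Fin 2) (Fin N → Fin 2) ℂ) := Matrix.linftyOpNormedRing
  let _ : NormedAlgebra ℝ (Matrix (Fin N → Fin 2) (Fin N → Fin 2) ℂ) :=
    Matrix.linftyOpNormedAlgebra
  have _ : NormOneClass (Matrix (Fin N → Fin 2) (Fin N → Fin 2) ℂ) := Matrix.linfty_opNormOneClass
  set T := fun x => trotterStep (β * v / √(N : ℝ)) (β * b) (coupling N J) x with hT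
  let φ : Matrix (Fin N → Fin 2) (Fin N → Fin 2) ℝ →+* Matrix (Fin N → Fin 2) (Fin N → Fin 2) ℂ :=
    Complex.ofRealHom.mapMatrix
  have h1 : Tendsto (fun n : ℕ => (n : ℝ) • (φ (T (1 / n)) - 1)) atTop
      (𝓝 (-(β : ℂ) • hamiltonian v b N J)) := by
    refine tendsto_pi_nhds.2 fun s => tendsto_pi_nhds.2 fun t => ?_
    rw [neg_smul_hamiltonian_apply]
    have h := tendsto_nsmul_sub_of_hasDerivAt
      (hasDerivAt_trotterStep (β * v / √(N : ℝ)) (β * b) (coupling N J) s t)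
    refine ((Complex.continuous_ofReal.tendsto _).comp h).congr fun n => ?_
    rw [trotterStep_zero]
    simp only [φ, hT, Function.comp_apply, Matrix.smul_apply, Matrix.sub_apply,
      RingHom.mapMatrix_apply, Matrix.map_apply, Complex.ofRealHom_eq_coe, Matrix.one_apply]
    split_ifs <;> simp
  have h2 := tendsto_pow_exp h1
  have h3 : Continuous fun M : Matrix (Fin N → Fin 2) (Fin N → Fin 2) ℂ => M.trace.re :=
    Complex.continuous_re.comp (Continuous.matrix_trace continuous_id)
  refine ((h3.tendsto _).comp h2).congr fun n => ?_
  rw [← trace_trotterStep_pow, Function.comp_apply, ← map_pow]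
  simp [φ, hT, Matrix.trace]

/-! ### From second moments to the logarithm -/

section Log
variable {α : Type*} [MeasurableSpace α] {μ : Measure α} [IsProbabilityMeasure μ] {Z : α → ℝ}

theorem integral_log_le_log_integral (hpos : ∀ x, 0 < Z x) (hZ : Integrable Z μ)
    (hlog : Integrable (fun x => Real.log (Z x)) μ) :
    ∫ x, Real.log (Z x) ∂μ ≤ Real.log (∫ x, Z x ∂μ) := by
  have hE : 0 < ∫ x, Z x ∂μ := by
    rw [integral_pos_iff_support_of_nonneg (fun x => (hpos x).le) hZ]
    simp [Function.support, (hpos _).ne']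
  set E := ∫ x, Z x ∂μ with hEdef
  calc ∫ x, Real.log (Z x) ∂μ ≤ ∫ x, (Z x / E + (Real.log E - 1)) ∂μ := by
        refine integral_mono hlog ((hZ.div_const E).add (integrable_const _)) fun x => ?_
        have h := Real.log_le_sub_one_of_pos (div_pos (hpos x) hE)
        rw [Real.log_div (hpos x).ne' hE.ne'] at h
        linarith
    _ = Real.log E := by
        rw [integral_add (hZ.div_const E) (integrable_const _), integral_div, ← hEdef,
          div_self hE.ne']
        simp

/-- If `E Z² ≤ C (E Z)²` and `ln Z` has variance at most `V`, then `E ln Z` exceeds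
`ln E Z - ln 2 - √(4CV)`: with positive probability `Z` is at least half its mean, and there
`ln Z` cannot be far above its own mean. -/
theorem log_integral_sub_le {C V : ℝ} (hC : 0 < C) (hpos : ∀ x, 0 < Z x) (hZ : Integrable Z μ)
    (hZ2 : Integrable (fun x => Z x ^ 2) μ)
    (hvar : Integrable (fun x => (Real.log (Z x) - ∫ y, Real.log (Z y) ∂μ) ^ 2) μ)
    (hV : ∫ x, (Real.log (Z x) - ∫ y, Real.log (Z y) ∂μ) ^ 2 ∂μ ≤ V)
    (hsecond : ∫ x, Z x ^ 2 ∂μ ≤ C * (∫ x, Z x ∂μ) ^ 2) :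
    Real.log (∫ x, Z x ∂μ) - ∫ x, Real.log (Z x) ∂μ ≤ Real.log 2 + √(4 * C * V) := by
  have hE : 0 < ∫ x, Z x ∂μ := by
    rw [integral_pos_iff_support_of_nonneg (fun x => (hpos x).le) hZ]
    simp [Function.support, (hpos _).ne']
  set E := ∫ x, Z x ∂μ with hEdef
  set L := ∫ x, Real.log (Z x) ∂μ
  set d := Real.log E - L - Real.log 2 with hd
  rcases le_or_gt d 0 with h0 | h0
  · linarith [Real.sqrt_nonneg (4 * C * V)]
  -- Integrating this bound gives `1 ≤ 1/2 + 1/4 + C V / d²`.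
  have hpt : ∀ x, Z x / E ≤ 1 / 2 + Z x ^ 2 / (4 * C * E ^ 2)
      + C / d ^ 2 * (Real.log (Z x) - L) ^ 2 := by
    intro x
    have hy : 0 < Z x / E := div_pos (hpos x) hE
    have e1 : Z x ^ 2 / (4 * C * E ^ 2) = (Z x / E) ^ 2 / (4 * C) := by
      field_simp
    rw [e1]
    rcases le_or_gt (Z x / E) (1 / 2) with h | h
    · have : 0 ≤ (Z x / E) ^ 2 / (4 * C) := by positivity
      have : 0 ≤ C / d ^ 2 * (Real.log (Z x) - L) ^ 2 := by positivity
      linarith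
    -- Here `log (Z x) - L ≥ d`, so the last term is at least `C`.
    · have h1 := Real.log_lt_log (by norm_num) h
      rw [one_div, Real.log_inv, Real.log_div (hpos x).ne' hE.ne'] at h1
      have h2 : d ^ 2 ≤ (Real.log (Z x) - L) ^ 2 :=
        pow_le_pow_left₀ h0.le (by linarith) 2
      have h3 : C ≤ C / d ^ 2 * (Real.log (Z x) - L) ^ 2 := by
        rw [div_mul_eq_mul_div, le_div_iff₀ (by positivity)]
        exact mul_le_mul_of_nonneg_left h2 hC.le
      have h4 : (Z x / E) ^ 2 / (4 * C) + C - Z x / E = (Z x / E - 2 * C) ^ 2 / (4 * C) := by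
        field_simp
        ring
      have h5 : 0 ≤ (Z x / E - 2 * C) ^ 2 / (4 * C) := by positivity
      linarith
  have hi2 : Integrable (fun x => 1 / 2 + Z x ^ 2 / (4 * C * E ^ 2)) μ :=
    (integrable_const _).add (hZ2.div_const _)
  have hi3 := hvar.const_mul (C / d ^ 2)
  have hint : ∫ x, Z x / E ∂μ ≤ ∫ x, (1 / 2 + Z x ^ 2 / (4 * C * E ^ 2)
      + C / d ^ 2 * (Real.log (Z x) - L) ^ 2) ∂μ :=
    integral_mono (hZ.div_const E) (hi2.add hi3) hpt
  have e2 : ∫ x, (1 / 2 + Z x ^ 2 / (4 * C * E ^ 2)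
      + C / d ^ 2 * (Real.log (Z x) - L) ^ 2) ∂μ = 1 / 2
        + (∫ x, Z x ^ 2 ∂μ) / (4 * C * E ^ 2)
        + C / d ^ 2 * ∫ x, (Real.log (Z x) - L) ^ 2 ∂μ := by
    rw [integral_add hi2 hi3, integral_add (integrable_const _) (hZ2.div_const _),
      integral_div (4 * C * E ^ 2), integral_const_mul]
    simp
  rw [integral_div, ← hEdef, div_self hE.ne', e2] at hint
  have h6 : (∫ x, Z x ^ 2 ∂μ) / (4 * C * E ^ 2) ≤ 1 / 4 := by
    rw [div_le_iff₀ (by positivity)]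
    linarith
  have h7 : C / d ^ 2 * ∫ x, (Real.log (Z x) - L) ^ 2 ∂μ ≤ C / d ^ 2 * V :=
    mul_le_mul_of_nonneg_left hV (by positivity)
  have h8 : 1 / 4 ≤ C * V / d ^ 2 := by
    rw [← div_mul_eq_mul_div]
    linarith
  rw [le_div_iff₀ (by positivity)] at h8
  have h9 : d ≤ √(4 * C * V) := Real.le_sqrt_of_sq_le (by linarith)
  linarith

end Log

/-! ### The partition function as a function of independent couplings -/

section Bounds
variable {X K : Type*} [Fintype X] [Fintype K] {w : X → ℝ} {u : X → K → ℝ} {N : ℕ} {c : ℝ}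

theorem pathZ_nonneg (hw : ∀ x, 0 ≤ w x) (J : Pairs N → ℝ) : 0 ≤ pathZ w u c J :=
  Finset.sum_nonneg fun _ _ => mul_nonneg (Finset.prod_nonneg fun _ _ => hw _) (Real.exp_nonneg _)

/-- Changing the couplings changes `ln pathZ` by at most `c` times the `ℓ¹`-distance, since the
overlaps are bounded by `1`. -/
theorem pathZ_le (hc : 0 ≤ c) (hu : ∀ x k, u x k ^ 2 = 1) (hw : ∀ x, 0 ≤ w x)
    (J J' : Pairs N → ℝ) :
    pathZ w u c J ≤ pathZ w u c J' * Real.exp (c * ∑ p, |J p - J' p|) := by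
  rw [pathZ, pathZ, Finset.sum_mul]
  refine Finset.sum_le_sum fun x _ => ?_
  rw [mul_assoc, ← Real.exp_add]
  refine mul_le_mul_of_nonneg_left (Real.exp_le_exp.2 ?_) (Finset.prod_nonneg fun _ _ => hw _)
  rw [Finset.mul_sum, ← Finset.sum_add_distrib]
  refine Finset.sum_le_sum fun p _ => ?_
  have h1 : overlap u (x p.1.1) (x p.1.2) * (J p - J' p) ≤ |J p - J' p| := by
    refine (le_abs_self _).trans ?_
    rw [abs_mul]
    exact mul_le_of_le_one_left (abs_nonneg _) (abs_overlap_le_one hu _ _)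
  have h2 := mul_le_mul_of_nonneg_left h1 hc
  linarith

theorem continuous_pathZ : Continuous fun J : Pairs N → ℝ => pathZ w u c J := by
  unfold pathZ
  fun_prop

end Bounds

theorem pathSpin_sq (n : ℕ) (x : Fin (n + 1) → Fin 2) (k : Fin n) : pathSpin n x k ^ 2 = 1 := by
  have : ∀ s, spin s ^ 2 = 1 := by intro s; fin_cases s <;> simp [spin]
  exact this _

theorem pathWeight_nonneg {r : ℝ} (hr : 0 ≤ r) (n : ℕ) (x : Fin (n + 1) → Fin 2) :
    0 ≤ pathWeight r n x := by
  unfold pathWeight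
  split_ifs
  · refine Finset.prod_nonneg fun k _ => ?_
    unfold stepWeight
    split_ifs
    exacts [zero_le_one, hr]
  · exact le_rfl

theorem one_le_sum_pathWeight {r : ℝ} (hr : 0 ≤ r) (n : ℕ) : 1 ≤ ∑ x, pathWeight r n x := by
  have h : pathWeight r n (fun _ => 0) = 1 := by simp [pathWeight, stepWeight]
  rw [← h]
  exact Finset.single_le_sum (fun x _ => pathWeight_nonneg hr n x) (Finset.mem_univ _)

/-- The global spin flip of a path. -/
def flipPath (n : ℕ) : Equiv.Perm (Fin (n + 1) → Fin 2) :=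
  Equiv.piCongrRight fun _ => Equiv.swap 0 1

theorem pathWeight_flipPath (r : ℝ) (n : ℕ) (x : Fin (n + 1) → Fin 2) :
    pathWeight r n (flipPath n x) = pathWeight r n x := by
  simp [pathWeight, flipPath, stepWeight]

theorem pathSpin_flipPath (n : ℕ) (x : Fin (n + 1) → Fin 2) (k : Fin n) :
    pathSpin n (flipPath n x) k = -pathSpin n x k := by
  have : ∀ s, spin (Equiv.swap 0 1 s) = -spin s := by intro s; fin_cases s <;> simp [spin]
  exact this _

/-- Couplings on all of `ℕ × ℕ` that extend given couplings of the pairs of `N` sites by zero. -/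
def extendCoupling {N : ℕ} (J : Pairs N → ℝ) (i j : ℕ) : ℝ :=
  if h : i < j ∧ j < N then J ⟨(⟨i, h.1.trans h.2⟩, ⟨j, h.2⟩), h.1⟩ else 0

theorem coupling_extendCoupling {N : ℕ} (J : Pairs N → ℝ) : coupling N (extendCoupling J) = J := by
  funext p
  have h : (p.1.1 : ℕ) < p.1.2 ∧ (p.1.2 : ℕ) < N := ⟨p.2, p.1.2.2⟩
  simp [coupling, extendCoupling, h]

/-- The partition function as a function of the finitely many couplings that enter it. -/
def pairPartition (β v b : ℝ) (N : ℕ) (J : Pairs N → ℝ) : ℝ :=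
  partitionFunction β v b N (extendCoupling J)

/-- The partition function of spin paths with `n` Trotter steps. -/
def trotterZ (β v b : ℝ) (N n : ℕ) (J : Pairs N → ℝ) : ℝ :=
  pathZ (pathWeight (β * b / n) n) (pathSpin n) (β * v / √(N : ℝ)) J

section Model
variable {β v b : ℝ} {N : ℕ}

theorem tendsto_trotterZ (J : Pairs N → ℝ) :
    Tendsto (fun n => trotterZ β v b N n J) atTop (𝓝 (pairPartition β v b N J)) := by
  have := tendsto_pathZ β v b N (extendCoupling J)
  rwa [coupling_extendCoupling] at this

/-- Both sides are limits of the same path partition functions, which see only the couplings of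
pairs `i < j < N`. -/
theorem partitionFunction_eq (J : ℕ → ℕ → ℝ) :
    partitionFunction β v b N J = pairPartition β v b N (coupling N J) :=
  tendsto_nhds_unique (tendsto_pathZ β v b N J) (tendsto_trotterZ _)

/-- Without couplings the path partition functions factorise over the sites. -/
theorem one_le_pairPartition_zero (hβ : 0 < β) (hb : 0 ≤ b) : 1 ≤ pairPartition β v b N 0 := by
  refine ge_of_tendsto' (tendsto_trotterZ 0) fun n => ?_
  have h : trotterZ β v b N n 0 = (∑ x, pathWeight (β * b / n) n x) ^ N := by
    rw [Finset.sum_pow', trotterZ, pathZ, Fintype.piFinset_univ]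
    simp
  rw [h]
  exact one_le_pow₀ (one_le_sum_pathWeight (by positivity) n)

variable (hβ : 0 < β) (hv : 0 < v) (hb : 0 ≤ b)
include hβ hv hb

theorem trotterZ_le (n : ℕ) (J J' : Pairs N → ℝ) : trotterZ β v b N n J ≤
    trotterZ β v b N n J' * Real.exp (β * v / √(N : ℝ) * ∑ p, |J p - J' p|) :=
  pathZ_le (by positivity) (pathSpin_sq n) (pathWeight_nonneg (by positivity) n) J J'

theorem pairPartition_le (J J' : Pairs N → ℝ) : pairPartition β v b N J ≤
    pairPartition β v b N J' * Real.exp (β * v / √(N : ℝ) * ∑ p, |J p - J' p|) :=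
  le_of_tendsto_of_tendsto' (tendsto_trotterZ J) ((tendsto_trotterZ J').mul_const _)
    fun n => trotterZ_le hβ hv hb n J J'

theorem pairPartition_pos (J : Pairs N → ℝ) : 0 < pairPartition β v b N J := by
  have h := (one_le_pairPartition_zero hβ hb).trans (pairPartition_le hβ hv hb 0 J)
  exact pos_of_mul_pos_left (zero_lt_one.trans_le h) (Real.exp_nonneg _)

theorem abs_log_pairPartition_sub_le (J J' : Pairs N → ℝ) :
    |Real.log (pairPartition β v b N J) - Real.log (pairPartition β v b N J')|
      ≤ β * v / √(N : ℝ) * ∑ p, |J p - J' p| := by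
  have key : ∀ J J' : Pairs N → ℝ, Real.log (pairPartition β v b N J)
      - Real.log (pairPartition β v b N J') ≤ β * v / √(N : ℝ) * ∑ p, |J p - J' p| := fun J J' => by
    have h := Real.log_le_log (pairPartition_pos hβ hv hb J) (pairPartition_le hβ hv hb J J')
    rw [Real.log_mul (pairPartition_pos hβ hv hb J').ne' (Real.exp_ne_zero _), Real.log_exp] at h
    linarith
  rw [abs_sub_le_iff]
  refine ⟨key J J', (key J' J).trans_eq ?_⟩
  simp only [abs_sub_comm]

theorem continuous_log_pairPartition :
    Continuous fun J => Real.log (pairPartition β v b N J) :=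
  continuous_of_abs_sub_le (abs_log_pairPartition_sub_le hβ hv hb)

theorem continuous_pairPartition : Continuous fun J => pairPartition β v b N J := by
  refine (Real.continuous_exp.comp (continuous_log_pairPartition hβ hv hb)).congr fun J => ?_
  exact Real.exp_log (pairPartition_pos hβ hv hb J)

theorem trotterZ_le_zero (n : ℕ) (J : Pairs N → ℝ) : trotterZ β v b N n J ≤
    trotterZ β v b N n 0 * Real.exp (β * v / √(N : ℝ) * ∑ p, |J p|) := by
  simpa using trotterZ_le hβ hv hb n J 0

/-- Moments of the path partition functions converge, by dominated convergence: all of them are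
at most a constant times `exp (c ∑ |J p|)`. -/
theorem tendsto_integral_trotterZ_pow (m : ℕ) :
    Integrable (fun J => pairPartition β v b N J ^ m) (stdGauss (Pairs N)) ∧
    Tendsto (fun n => ∫ J, trotterZ β v b N n J ^ m ∂(stdGauss (Pairs N))) atTop
      (𝓝 (∫ J, pairPartition β v b N J ^ m ∂(stdGauss (Pairs N)))) := by
  set c := β * v / √(N : ℝ) with hc
  set B := pairPartition β v b N 0 + 1 with hB
  have hB0 : 0 ≤ B := by linarith [(pairPartition_pos hβ hv hb (N := N) 0)]
  have hdom : ∀ z (J : Pairs N → ℝ), 0 ≤ z → z ≤ B * Real.exp (c * ∑ p, |J p|) →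
      ‖z ^ m‖ ≤ B ^ m * Real.exp ((m * c) * ∑ p, |J p|) := fun z J h0 h => by
    rw [Real.norm_of_nonneg (pow_nonneg h0 m), mul_assoc (m : ℝ), Real.exp_nat_mul, ← mul_pow]
    exact pow_le_pow_left₀ h0 h m
  have hint : Integrable (fun J : Pairs N → ℝ => B ^ m * Real.exp ((m * c) * ∑ p, |J p|))
      (stdGauss (Pairs N)) := (integrable_exp_abs_stdGauss (m * c)).const_mul _
  constructor
  · refine hint.mono' ((continuous_pairPartition hβ hv hb).pow m).aestronglyMeasurable
      (.of_forall fun J => hdom _ J (pairPartition_pos hβ hv hb J).le ?_)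
    have h := pairPartition_le hβ hv hb J 0
    simp only [Pi.zero_apply, sub_zero] at h
    exact h.trans (mul_le_mul_of_nonneg_right (by linarith) (Real.exp_nonneg _))
  · refine tendsto_integral_filter_of_dominated_convergence _
      (.of_forall fun n => (continuous_pathZ.pow m).aestronglyMeasurable) ?_ hint
      (.of_forall fun J => (tendsto_trotterZ J).pow m)
    filter_upwards [(tendsto_trotterZ (β := β) (v := v) (b := b) (N := N) 0).eventually_le_const
      (lt_add_one _)] with n hn
    refine .of_forall fun J => hdom _ J
      (pathZ_nonneg (pathWeight_nonneg (by positivity) n) J) ?_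
    exact (trotterZ_le_zero hβ hv hb n J).trans
      (mul_le_mul_of_nonneg_right hn (Real.exp_nonneg _))

theorem integrable_pairPartition :
    Integrable (fun J => pairPartition β v b N J) (stdGauss (Pairs N)) := by
  simpa using (tendsto_integral_trotterZ_pow hβ hv hb (N := N) 1).1

theorem tendsto_integral_trotterZ :
    Tendsto (fun n => ∫ J, trotterZ β v b N n J ∂(stdGauss (Pairs N))) atTop
      (𝓝 (∫ J, pairPartition β v b N J ∂(stdGauss (Pairs N)))) := by
  simpa using (tendsto_integral_trotterZ_pow hβ hv hb (N := N) 1).2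

/-- In the weak-disorder regime the relative second moment of `Z` is bounded uniformly in `N`. -/
theorem integral_pairPartition_sq_le (hweak : β ^ 2 * v ^ 2 < 1) :
    ∫ J, pairPartition β v b N J ^ 2 ∂(stdGauss (Pairs N)) ≤ gaussConst (β ^ 2 * v ^ 2)
      * (∫ J, pairPartition β v b N J ∂(stdGauss (Pairs N))) ^ 2 := by
  refine le_of_tendsto_of_tendsto (tendsto_integral_trotterZ_pow hβ hv hb 2).2
    (((tendsto_integral_trotterZ hβ hv hb).pow 2).const_mul _) ?_
  filter_upwards [eventually_gt_atTop 0] with n hn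
  have : Nonempty (Fin n) := ⟨⟨0, hn⟩⟩
  refine integral_pathZ_sq_le (by positivity) hweak ?_ (pathSpin_sq n)
    (pathWeight_nonneg (by positivity) n) (flipPath n) (pathWeight_flipPath _ n)
    (pathSpin_flipPath n)
  rw [div_pow, Real.sq_sqrt (by positivity), mul_pow]

/-- The annealed partition function, multiplied by `exp (β² v² / 4)`, is the limit of the
annealed partition functions of spin paths. -/
theorem tendsto_pathA (hN : N ≠ 0) :
    Tendsto (fun n : ℕ => pathA (pathWeight (β * b / n) n) (pathSpin n) (β ^ 2 * v ^ 2) N) atTop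
      (𝓝 (Real.exp (β ^ 2 * v ^ 2 / 4) *
        ∫ J, pairPartition β v b N J ∂(stdGauss (Pairs N)))) := by
  refine ((tendsto_integral_trotterZ hβ hv hb).const_mul _).congr' ?_
  filter_upwards [eventually_gt_atTop 0] with n hn
  have : Nonempty (Fin n) := ⟨⟨0, hn⟩⟩
  unfold trotterZ
  rw [integral_pathZ_eq_pathA (a := β ^ 2 * v ^ 2) hN _ (pathSpin_sq n), ← mul_assoc,
    ← Real.exp_add]
  · rw [neg_div, add_neg_cancel, Real.exp_zero, one_mul]
  · rw [div_pow, Real.sq_sqrt (by positivity), mul_pow]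

/-- Existence of the annealed limit: `ln E Z`, corrected by the constant `β² v² / 4`, is subadditive
in `N` and nonnegative, so Fekete's lemma applies. -/
theorem exists_tendsto_log_integral : ∃ l : ℝ, Tendsto (fun N : ℕ =>
    Real.log (∫ J, pairPartition β v b N J ∂(stdGauss (Pairs N))) / N) atTop (𝓝 l) := by
  set a := β ^ 2 * v ^ 2
  set E : ℕ → ℝ := fun N => Real.exp (a / 4) * ∫ J, pairPartition β v b N J ∂(stdGauss (Pairs N))
    with hE
  have hE1 : ∀ N, N ≠ 0 → 1 ≤ E N := fun N hN =>
    ge_of_tendsto' (tendsto_pathA hβ hv hb hN) fun n =>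
      (one_le_pow₀ (one_le_sum_pathWeight (by positivity) n)).trans
        (pow_le_pathA (by positivity) (pathWeight_nonneg (by positivity) n))
  let U : ℕ → ℝ := fun N => if N = 0 then 0 else Real.log (E N)
  have hU : Subadditive U := by
    intro M N
    rcases eq_or_ne M 0 with rfl | hM
    · simp [U]
    rcases eq_or_ne N 0 with rfl | hN
    · simp [U]
    have hMN : M + N ≠ 0 := by omega
    have h0 : ∀ N, N ≠ 0 → E N ≠ 0 := fun N hN => (zero_lt_one.trans_le (hE1 N hN)).ne'
    simp only [U, hM, hN, hMN, if_false]
    rw [← Real.log_mul (h0 M hM) (h0 N hN)]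
    refine Real.log_le_log (zero_lt_one.trans_le (hE1 _ hMN)) ?_
    exact le_of_tendsto_of_tendsto' (tendsto_pathA hβ hv hb hMN)
      ((tendsto_pathA hβ hv hb hM).mul (tendsto_pathA hβ hv hb hN)) fun n =>
      pathA_add_le (by positivity) (pathWeight_nonneg (by positivity) n) hM hN
  have hbdd : BddBelow (Set.range fun N : ℕ => U N / N) := by
    refine ⟨0, ?_⟩
    rintro _ ⟨N, rfl⟩
    refine div_nonneg ?_ (Nat.cast_nonneg N)
    simp only [U]
    split_ifs with h
    exacts [le_rfl, Real.log_nonneg (hE1 N h)]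
  refine ⟨hU.lim, ?_⟩
  have h1 := (hU.tendsto_lim hbdd).sub (tendsto_const_div_atTop_nhds_zero_nat (a / 4))
  rw [sub_zero] at h1
  refine h1.congr' ?_
  filter_upwards [eventually_ne_atTop 0] with N hN
  have hpos : 0 < ∫ J, pairPartition β v b N J ∂(stdGauss (Pairs N)) :=
    pos_of_mul_pos_right (zero_lt_one.trans_le (hE1 N hN)) (Real.exp_nonneg _)
  simp only [U, hN, if_false, hE]
  rw [Real.log_mul (Real.exp_ne_zero _) hpos.ne', Real.log_exp]
  ring

/-- The variance of `ln Z` is of order `N`: there are fewer than `N ^ 2` couplings, and `ln Z` is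
Lipschitz in each of them with a constant of order `1 / √N`. -/
theorem variance_log_pairPartition_le (hN : N ≠ 0) :
    ∫ J, (Real.log (pairPartition β v b N J)
      - ∫ J', Real.log (pairPartition β v b N J') ∂(stdGauss (Pairs N))) ^ 2 ∂(stdGauss (Pairs N))
      ≤ β ^ 2 * v ^ 2 * N := by
  refine (variance_le (abs_log_pairPartition_sub_le hβ hv hb)).trans ?_
  have hcard : (Fintype.card (Pairs N) : ℝ) ≤ (N : ℝ) * N := by
    have := Fintype.card_subtype_le fun p : Fin N × Fin N => p.1 < p.2
    rw [Fintype.card_prod, Fintype.card_fin] at this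
    exact_mod_cast this
  have hN' : (0 : ℝ) < N := by positivity
  rw [div_pow, Real.sq_sqrt hN'.le, mul_pow]
  calc _ ≤ (N : ℝ) * N * (β ^ 2 * v ^ 2 / N) := by gcongr
    _ = _ := by field_simp

/-- For weak disorder, `E ln Z` and `ln E Z` agree to leading order in `N`. -/
theorem tendsto_log_integral_sub (hweak : β ^ 2 * v ^ 2 < 1) :
    Tendsto (fun N : ℕ => (Real.log (∫ J, pairPartition β v b N J ∂(stdGauss (Pairs N)))
      - ∫ J, Real.log (pairPartition β v b N J) ∂(stdGauss (Pairs N))) / N) atTop (𝓝 0) := by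
  set a := β ^ 2 * v ^ 2
  have hC := gaussConst_pos hweak
  set C := gaussConst a
  have h1 : Tendsto (fun N : ℕ => Real.log 2 / (N : ℝ) + √(4 * C * a / N)) atTop (𝓝 0) := by
    have h2 := (tendsto_const_div_atTop_nhds_zero_nat (4 * C * a)).sqrt
    rw [Real.sqrt_zero] at h2
    simpa using (tendsto_const_div_atTop_nhds_zero_nat (Real.log 2)).add h2
  refine squeeze_zero' (.of_forall fun N => ?_) ?_ h1
  · refine div_nonneg (sub_nonneg.2 ?_) (Nat.cast_nonneg N)
    exact integral_log_le_log_integral (pairPartition_pos hβ hv hb)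
      (integrable_pairPartition hβ hv hb)
      (integrable_of_abs_sub_le (abs_log_pairPartition_sub_le hβ hv hb))
  · filter_upwards [eventually_ne_atTop 0] with N hN
    have hN' : (0 : ℝ) < N := by positivity
    have h3 := log_integral_sub_le hC (pairPartition_pos hβ hv hb)
      (integrable_pairPartition hβ hv hb) (tendsto_integral_trotterZ_pow hβ hv hb 2).1
      (integrable_sub_sq_of_abs_sub_le (abs_log_pairPartition_sub_le hβ hv hb) _)
      (variance_log_pairPartition_le hβ hv hb hN) (integral_pairPartition_sq_le hβ hv hb hweak)
    refine (div_le_div_of_nonneg_right h3 hN'.le).trans_eq ?_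
    rw [add_div]
    congr 1
    rw [div_eq_iff hN'.ne', ← Real.sqrt_sq hN'.le, ← Real.sqrt_mul' _ (by positivity),
      Real.sqrt_sq hN'.le]
    congr 1
    field_simp
    rfl

end Model

/-! ### Gaussian disorder -/

section Disorder
variable {Ω : Type*} [MeasurableSpace Ω] {P : Measure Ω} [IsProbabilityMeasure P]
  {g : ℕ → ℕ → Ω → ℝ}

theorem IsGaussianDisorder.hasLaw_coupling (hg : IsGaussianDisorder P g) (N : ℕ) :
    HasLaw (fun ω => coupling N fun i j => g i j ω) (stdGauss (Pairs N)) P := by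
  have hlaw : ∀ p : Pairs N, HasLaw (g p.1.1 p.1.2) (gaussianReal 0 1) P := fun p =>
    hg.hasLaw _ _ p.2
  have hm : ∀ p : Pairs N, AEMeasurable (g p.1.1 p.1.2) P := fun p => (hlaw p).aemeasurable
  let e : Pairs N → {p : ℕ × ℕ // p.1 < p.2} := fun p => ⟨(p.1.1, p.1.2), p.2⟩
  have he : Function.Injective e := by
    rintro ⟨⟨i, j⟩, h⟩ ⟨⟨i', j'⟩, h'⟩ heq
    simp only [e, Subtype.mk.injEq, Prod.mk.injEq, Fin.val_inj] at heq
    simp [heq.1, heq.2]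
  have hind : iIndepFun (fun p : Pairs N => g p.1.1 p.1.2) P := hg.indep.precomp he
  refine ⟨aemeasurable_pi_lambda _ hm, ?_⟩
  have h := (iIndepFun_iff_map_fun_eq_pi_map hm).1 hind
  simp only [(hlaw _).map_eq] at h
  exact h

end Disorder

end QuantumSK

end

theorem mainTheorem1 {Ω : Type*} [MeasurableSpace Ω] (P : MeasureTheory.Measure Ω)
    [MeasureTheory.IsProbabilityMeasure P] (g : ℕ → ℕ → Ω → ℝ)
    (hg : QuantumSK.IsGaussianDisorder P g)
    (β v b : ℝ) (hβ : 0 < β) (hv : 0 < v) (hb : 0 ≤ b)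
    (hweak : 4 * QuantumSK.disorderParameter β v < 1) :
    (∀ N : ℕ, 2 ≤ N →
      Integrable (fun ω => QuantumSK.partitionFunction β v b N (fun i j => g i j ω)) P ∧
      Integrable (fun ω => QuantumSK.freeEnergy β v b N (fun i j => g i j ω)) P) ∧
    Tendsto (fun N : ℕ => QuantumSK.annealedFreeEnergy P g β v b N) atTop
      (𝓝 (QuantumSK.macroscopicAnnealedFreeEnergy P g β v b)) ∧
    Tendsto (fun N : ℕ => QuantumSK.quenchedFreeEnergy P g β v b N) atTop
      (𝓝 (QuantumSK.macroscopicAnnealedFreeEnergy P g β v b)) := by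
  open QuantumSK in
  have hw : β ^ 2 * v ^ 2 < 1 := by
    unfold disorderParameter at hweak
    linarith
  have hG := fun N => hg.hasLaw_coupling N
  have hlogint : ∀ N, Integrable (fun J => Real.log (pairPartition β v b N J))
      (stdGauss (Pairs N)) := fun N =>
    integrable_of_abs_sub_le (abs_log_pairPartition_sub_le hβ hv hb)
  have hint : ∀ N (F : (Pairs N → ℝ) → ℝ), Integrable F (stdGauss (Pairs N)) →
      Integrable (fun ω => F (coupling N fun i j => g i j ω)) P := fun N F hF => by
    rw [← (hG N).map_eq] at hF
    exact hF.comp_aemeasurable (hG N).aemeasurable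
  have hintegral : ∀ N (F : (Pairs N → ℝ) → ℝ), Continuous F →
      ∫ ω, F (coupling N fun i j => g i j ω) ∂P = ∫ J, F J ∂(stdGauss (Pairs N)) :=
    fun N F hF => by
      rw [← (hG N).map_eq, integral_map (hG N).aemeasurable hF.aestronglyMeasurable]
  have hann : ∀ N, annealedFreeEnergy P g β v b N = -(1 / β) *
      (Real.log (∫ J, pairPartition β v b N J ∂(stdGauss (Pairs N))) / N) := fun N => by
    unfold annealedFreeEnergy
    simp only [partitionFunction_eq]
    rw [hintegral N _ (continuous_pairPartition hβ hv hb), ← div_div]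
    ring
  have hque : ∀ N, quenchedFreeEnergy P g β v b N = annealedFreeEnergy P g β v b N + 1 / β *
      ((Real.log (∫ J, pairPartition β v b N J ∂(stdGauss (Pairs N)))
        - ∫ J, Real.log (pairPartition β v b N J) ∂(stdGauss (Pairs N))) / N) := fun N => by
    rw [hann]
    unfold quenchedFreeEnergy freeEnergy
    simp only [partitionFunction_eq]
    rw [integral_const_mul, hintegral N _ (continuous_log_pairPartition hβ hv hb), ← div_div]
    ring
  obtain ⟨l, hl⟩ := exists_tendsto_log_integral hβ hv hb
  have hA : Tendsto (fun N : ℕ => annealedFreeEnergy P g β v b N) atTop (𝓝 (-(1 / β) * l)) := by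
    simp only [hann]
    exact hl.const_mul _
  have hlim : macroscopicAnnealedFreeEnergy P g β v b = -(1 / β) * l := hA.limUnder_eq
  refine ⟨fun N _ => ⟨?_, ?_⟩, hlim ▸ hA, ?_⟩
  · simp only [partitionFunction_eq]
    exact hint N _ (integrable_pairPartition hβ hv hb)
  · unfold freeEnergy
    simp only [partitionFunction_eq]
    exact (hint N _ (hlogint N)).const_mul _
  · simp only [hque]
    rw [hlim]
    simpa using hA.add ((tendsto_log_integral_sub hβ hv hb hw).const_mul (1 / β))
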